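/- Let $N\ge 2$, let $\Omega\subset\mathbb R^N$ be a bounded domain (nonempty, open, connected) with Lipschitz boundary, and let $p\in C(\overline\Omega)$ satisfy $1<\inf_\Omega p\le\sup_\Omega p<N$ and be log-Hölder continuous: for some $L>0$, $|p(x)-p(y)|\le -L/\log|x-y|$ for all $x,y\in\Omega$ with $0<|x-y|\le 1/2$. Let $L^{p(x)}(\Omega)$ be the space of measurable $u$ with $\int_\Omega|u|^{p(x)}\,dx<\infty$, with the Luxemburg norm $\|u\|_{p(x)}=\inf\{\gamma>0:\int_\Omega|u/\gamma|^{p(x)}dx\le1\}$, and let $W_0^{1,p(x)}(\Omega)$ be the closure of $C_c^\infty(\Omega)$ in $W^{1,p(x)}(\Omega)=\{u\in L^{p(x)}(\Omega):\nabla u\in L^{p(x)}(\Omega)\}$ with respect to $\|u\|_{p(x)}+\|\nabla u\|_{p(x)}$, endowed with the norm $\|\nabla u\|_{p(x)}$. Define $\mathscr E_{p(x)}:L^1(\Omega)\to[0,\infty]$ and $g_{p(x)}:L^1(\Omega)\to[0,\infty)$ by $$\mathscr E_{p(x)}(u)=\begin{cases}\|\nabla u\|_{p(x)}&\text{if }u\in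 W_0^{1,p(x)}(\Omega),\\+\infty&\text{otherwise,}\end{cases}\qquad g_{p(x)}(u)=\begin{cases}\|u\|_{p(x)}&\text{if }u\in L^{p(x)}(\Omega),\\0&\text{otherwise.}\end{cases}$$ The Krasnosel'skiĭ genus $i(K)$ of a symmetric set $K=-K$ is the least integer $k\ge0$ for which there is a continuous odd map $K\to\mathbb R^k\setminus\{0\}$ ($i(K)=\infty$ if there is none; $i(\emptyset)=0$). For $m\ge1$ let $\mathcal K^{(m)}_{s,p(x)}$ be the family of the symmetric subsets $K$ of $\{u\in L^1(\Omega):g_{p(x)}(u)=1\}$ that are compact and satisfy $i(K)\ge m$ with respect to the topology of $L^1(\Omega)$, and let $\mathcal W^{(m)}_{s,p(x)}$ be the family of the symmetric subsets $K$ of $\{u\in W_0^{1,p(x)}(\Omega):g_{p(x)}(u)=1\}$ that are compact and satisfy $i(K)\ge m$ with respect to the norm topology of $W_0^{1,p(x)}(\Omega)$. Then $\mathscr E_{p(x)}$ is convex, even and positively homogeneous of degree $1$ (that is, $\mathscr E_{p(x)}(tu)=t\,\mathscr E_{p(x)}(u)$ for all $t\ge0$ and $u\in L^1(\Omega)$,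 with $0\cdot\infty=0$), and for every integer $m\ge1$ $$\inf_{K\in\mathcal K^{(m)}_{s,p(x)}}\ \sup_{u\in K}\mathscr E_{p(x)}(u)=\inf_{K\in\mathcal W^{(m)}_{s,p(x)}}\ \sup_{u\in K}\mathscr E_{p(x)}(u).$$ -/

import Mathlib

open MeasureTheory Set
open scoped ENNReal NNReal ContDiff Pointwise

namespace VarExp

/-- `ℝ^N` with its Euclidean norm. -/
abbrev Euc (N : ℕ) : Type := EuclideanSpace ℝ (Fin N)

variable {N : ℕ}

/-- Near each of its boundary points, `Ω` is (in suitable orthonormal coordinates) the region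
strictly above the graph of a Lipschitz function of `N - 1` variables. -/
def HasLipschitzBoundary (Ω : Set (Euc N)) : Prop :=
  ∀ x₀ ∈ frontier Ω, ∃ e : Euc N, ‖e‖ = 1 ∧
    ∃ (r : ℝ) (C : ℝ≥0) (γ : (Submodule.span ℝ {e})ᗮ → ℝ), 0 < r ∧ LipschitzWith C γ ∧
      ∀ x ∈ Metric.ball x₀ r,
        (x ∈ Ω ↔ γ ((Submodule.span ℝ {e})ᗮ.orthogonalProjectionOnto x) < inner ℝ e x)

/-- The class `𝒞` of admissible exponents on `Ω`. Only the values of `p` on `closure Ω` matter. -/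
structure AdmissibleExponent (Ω : Set (Euc N)) (p : Euc N → ℝ) : Prop where
  continuousOn : ContinuousOn p (closure Ω)
  one_lt_inf : 1 < sInf (p '' Ω)
  sup_lt : sSup (p '' Ω) < N
  log_holder : ∃ L : ℝ, 0 < L ∧ ∀ x ∈ Ω, ∀ y ∈ Ω, 0 < dist x y → dist x y ≤ 1 / 2 →
    |p x - p y| ≤ -(L / Real.log (dist x y))

section Lebesgue

variable {F : Type*} [NormedAddCommGroup F]

/-- The `p(x)`-modular `∫_Ω |f|^{p(x)} dx`. -/
noncomputable def modular (Ω : Set (Euc N)) (p : Euc N → ℝ) (f : Euc N → F) : ℝ≥0∞ :=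
  ∫⁻ x in Ω, ‖f x‖ₑ ^ p x

/-- Membership in `L^{p(x)}(Ω)`. -/
def MemLpx (Ω : Set (Euc N)) (p : Euc N → ℝ) (f : Euc N → F) : Prop :=
  AEStronglyMeasurable f (volume.restrict Ω) ∧ modular Ω p f < ⊤

/-- The Luxemburg norm `‖f‖_{p(x)}` (with value `∞` when no `γ > 0` is admissible). -/
noncomputable def luxNorm [NormedSpace ℝ F] (Ω : Set (Euc N)) (p : Euc N → ℝ)
    (f : Euc N → F) : ℝ≥0∞ :=
  ⨅ (γ : ℝ) (_ : 0 < γ) (_ : modular Ω p (fun x => γ⁻¹ • f x) ≤ 1), ENNReal.ofReal γ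

end Lebesgue

/-- Smooth functions with compact support contained in `Ω`. -/
def IsTestFunction (Ω : Set (Euc N)) (φ : Euc N → ℝ) : Prop :=
  ContDiff ℝ ∞ φ ∧ HasCompactSupport φ ∧ tsupport φ ⊆ Ω

/-- `G` is the distributional gradient of `u` on `Ω`. -/
def IsWeakGrad (Ω : Set (Euc N)) (u : Euc N → ℝ) (G : Euc N → Euc N) : Prop :=
  LocallyIntegrableOn u Ω ∧ LocallyIntegrableOn G Ω ∧
    ∀ φ : Euc N → ℝ, IsTestFunction Ω φ →
      ∫ x in Ω, u x • gradient φ x = -∫ x in Ω, φ x • G x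

open Classical in
/-- The distributional gradient of `u` on `Ω` (unique almost everywhere), when there is one. -/
noncomputable def weakGrad (Ω : Set (Euc N)) (u : Euc N → ℝ) : Euc N → Euc N :=
  if h : ∃ G, IsWeakGrad Ω u G then h.choose else 0

/-- Membership in `W_0^{1,p(x)}(Ω)`: `u` belongs to `W^{1,p(x)}(Ω)` and is a limit of test functions
in the norm `‖u‖_{p(x)} + ‖∇u‖_{p(x)}`. -/
def MemW0 (Ω : Set (Euc N)) (p : Euc N → ℝ) (u : Euc N → ℝ) : Prop :=
  MemLpx Ω p u ∧ ∃ G : Euc N → Euc N, IsWeakGrad Ω u G ∧ MemLpx Ω p G ∧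
    ∀ ε : ℝ≥0∞, 0 < ε → ∃ φ : Euc N → ℝ, IsTestFunction Ω φ ∧
      luxNorm Ω p (fun x => u x - φ x) + luxNorm Ω p (fun x => G x - gradient φ x) < ε

/-- `L¹(Ω)` with its norm topology. -/
abbrev L1 (Ω : Set (Euc N)) : Type := Lp ℝ 1 (volume.restrict Ω)

/-- `‖∇u‖_{p(x)}`. -/
noncomputable def gradNorm (Ω : Set (Euc N)) (p : Euc N → ℝ) (u : L1 Ω) : ℝ≥0∞ :=
  luxNorm Ω p (weakGrad Ω u)

open Classical in
/-- The functional `ℰ_{p(x)} : L¹(Ω) → [0, ∞]`. -/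
noncomputable def energy (Ω : Set (Euc N)) (p : Euc N → ℝ) (u : L1 Ω) : ℝ≥0∞ :=
  if MemW0 Ω p u then gradNorm Ω p u else ⊤

open Classical in
/-- The functional `g_{p(x)} : L¹(Ω) → [0, ∞)`. -/
noncomputable def gFun (Ω : Set (Euc N)) (p : Euc N → ℝ) (u : L1 Ω) : ℝ≥0 :=
  if MemLpx Ω p u then (luxNorm Ω p u).toNNReal else 0

/-- The space `W_0^{1,p(x)}(Ω)`. A type of its own: it does not carry the topology of `L¹(Ω)`. -/
def W0 (Ω : Set (Euc N)) (p : Euc N → ℝ) : Type := {u : L1 Ω // MemW0 Ω p u}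

/-- The norm topology of `W_0^{1,p(x)}(Ω)` for the norm `‖∇u‖_{p(x)}`: a set is open when it contains
a ball around each of its points. -/
instance W0.instTopologicalSpace (Ω : Set (Euc N)) (p : Euc N → ℝ) :
    TopologicalSpace (W0 Ω p) where
  IsOpen U := ∀ u ∈ U, ∃ ε : ℝ≥0∞, 0 < ε ∧ ∀ v : W0 Ω p, gradNorm Ω p (v.1 - u.1) < ε → v ∈ U
  isOpen_univ := fun _ _ => ⟨1, one_pos, fun _ _ => mem_univ _⟩
  isOpen_inter := by
    rintro U V hU hV u ⟨hu, hv⟩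
    obtain ⟨a, ha, hUa⟩ := hU u hu
    obtain ⟨b, hb, hVb⟩ := hV u hv
    exact ⟨min a b, lt_min ha hb, fun v h =>
      ⟨hUa v (h.trans_le (min_le_left _ _)), hVb v (h.trans_le (min_le_right _ _))⟩⟩
  isOpen_sUnion := by
    rintro S hS u ⟨U, hU, hu⟩
    obtain ⟨a, ha, h⟩ := hS U hU u hu
    exact ⟨a, ha, fun v hv => ⟨U, hU, h v hv⟩⟩

section Neg

variable {F : Type*} [NormedAddCommGroup F]

theorem modular_congr {Ω : Set (Euc N)} {p : Euc N → ℝ} {F' : Type*} [NormedAddCommGroup F']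
    {f : Euc N → F} {g : Euc N → F'} (h : ∀ᵐ x ∂volume.restrict Ω, ‖f x‖ₑ = ‖g x‖ₑ) :
    modular Ω p f = modular Ω p g :=
  lintegral_congr_ae (h.mono fun x hx => by simp only [hx])

theorem luxNorm_congr [NormedSpace ℝ F] {Ω : Set (Euc N)} {p : Euc N → ℝ}
    {f g : Euc N → F} (h : ∀ᵐ x ∂volume.restrict Ω, ‖f x‖ₑ = ‖g x‖ₑ) :
    luxNorm Ω p f = luxNorm Ω p g := by
  have key : ∀ γ : ℝ, modular Ω p (fun x => γ⁻¹ • f x) = modular Ω p (fun x => γ⁻¹ • g x) :=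
    fun γ => modular_congr (h.mono fun x hx => by simp only [enorm_smul, hx])
  simp only [luxNorm, key]

theorem gradient_fun_neg (φ : Euc N → ℝ) (x : Euc N) :
    gradient (fun y => -φ y) x = -gradient φ x := by
  simp [gradient, fderiv_fun_neg]

theorem IsTestFunction.neg {Ω : Set (Euc N)} {φ : Euc N → ℝ} (h : IsTestFunction Ω φ) :
    IsTestFunction Ω (fun x => -φ x) := by
  have hs : Function.support (fun x => -φ x) = Function.support φ := by
    ext x; simp
  refine ⟨h.1.neg, ?_, ?_⟩
  · have := h.2.1
    rw [HasCompactSupport, tsupport] at this ⊢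
    rwa [hs]
  · have := h.2.2
    rw [tsupport] at this ⊢
    rwa [hs]

theorem MemW0.neg {Ω : Set (Euc N)} {p : Euc N → ℝ} {u : L1 Ω} (h : MemW0 Ω p u) :
    MemW0 Ω p (-u : L1 Ω) := by
  obtain ⟨hu, G, ⟨hG1, hG2, hG3⟩, hG, happ⟩ := h
  have hneg : ∀ᵐ x ∂volume.restrict Ω, (-u : L1 Ω) x = -u x := Lp.coeFn_neg u
  refine ⟨⟨Lp.aestronglyMeasurable _, ?_⟩, fun x => -G x, ⟨?_, ?_, ?_⟩, ⟨hG.1.neg, ?_⟩, ?_⟩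
  · rw [modular_congr (g := u) (hneg.mono fun x hx => by rw [hx, enorm_neg])]
    exact hu.2
  · have : Integrable (-u : L1 Ω) (volume.restrict Ω) := L1.integrable_coeFn _
    exact IntegrableOn.locallyIntegrableOn this
  · exact hG2.neg
  · intro φ hφ
    have h1 : ∫ x in Ω, (-u : L1 Ω) x • gradient φ x = ∫ x in Ω, -(u x • gradient φ x) :=
      integral_congr_ae (hneg.mono fun x hx => by simp only [hx, neg_smul])
    rw [h1, integral_neg, hG3 φ hφ]
    simp only [smul_neg, integral_neg]
  · rw [modular_congr (g := G) (Filter.Eventually.of_forall fun x => enorm_neg _)]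
    exact hG.2
  · intro ε hε
    obtain ⟨φ, hφ, hlt⟩ := happ ε hε
    refine ⟨fun x => -φ x, hφ.neg, ?_⟩
    rw [luxNorm_congr (g := fun x => u x - φ x) (hneg.mono fun x hx => ?_),
      luxNorm_congr (g := fun x => G x - gradient φ x) (Filter.Eventually.of_forall fun x => ?_)]
    · exact hlt
    · have e : -G x - gradient (fun y => -φ y) x = -(G x - gradient φ x) := by
        rw [gradient_fun_neg]; abel
      rw [e, enorm_neg]
    · have e : (-u : L1 Ω) x - -φ x = -(u x - φ x) := by
        rw [hx]; ring
      rw [e, enorm_neg]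

end Neg

noncomputable instance W0.instNeg (Ω : Set (Euc N)) (p : Euc N → ℝ) : Neg (W0 Ω p) :=
  ⟨fun u => ⟨-u.1, u.2.neg⟩⟩

/-- The Krasnosel'skii genus of a symmetric set `A`: the least `k` for which there is an odd
continuous map from `A` to `ℝ^k` without zeros (`∞` if there is none, `0` for the empty set). -/
noncomputable def genus {X : Type*} [TopologicalSpace X] [Neg X] (A : Set X) : ℕ∞ :=
  ⨅ (k : ℕ) (_ : ∃ f : X → EuclideanSpace ℝ (Fin k), ContinuousOn f A ∧
    (∀ x ∈ A, f (-x) = -f x) ∧ ∀ x ∈ A, f x ≠ 0), (k : ℕ∞)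

/-- The compact symmetric subsets of `S` with genus at least `m`, everything being understood in the
topology of `X`. -/
def symmFamily {X : Type*} [TopologicalSpace X] [Neg X] (S : Set X) (m : ℕ) : Set (Set X) :=
  {K | K ⊆ S ∧ IsCompact K ∧ K = -K ∧ (m : ℕ∞) ≤ genus K}

/-- The family of subsets of `{u ∈ L¹(Ω) : g_{p(x)}(u) = 1}`, with the topology of `L¹(Ω)`. -/
def familyL1 (Ω : Set (Euc N)) (p : Euc N → ℝ) (m : ℕ) : Set (Set (L1 Ω)) :=
  symmFamily {u : L1 Ω | gFun Ω p u = 1} m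

/-- The family of subsets of `{u ∈ W_0^{1,p(x)}(Ω) : g_{p(x)}(u) = 1}`, with the norm topology of
`W_0^{1,p(x)}(Ω)`. -/
def familyW0 (Ω : Set (Euc N)) (p : Euc N → ℝ) (m : ℕ) : Set (Set (W0 Ω p)) :=
  symmFamily {u : W0 Ω p | gFun Ω p u.1 = 1} m

end VarExp

namespace VarExp

variable {N : ℕ}

/-! The functional `energy` is an extended seminorm on `L1 Ω`, finite exactly on `W_0^{1,p(x)}(Ω)`;
convexity, evenness and homogeneity follow from this.

For the minimax values, one inequality is soft. By a Poincaré inequality, `W_0^{1,p(x)}(Ω)` embeds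
continuously in `L¹(Ω)`, and a continuous odd map preserves compactness and symmetry and does not
lower the genus, so every competitor in `familyW0` is also one in `familyL1` (`iInf_familyL1_le`).

Conversely, let `K` in `familyL1` have energy at most `c < ∞`. It need not be compact in the
stronger norm, so it is replaced by a nearby set in a finite-dimensional space: an odd Schauder
projection `P` sends each `u ∈ K` within `δ` in `L¹` to a combination of finitely many points of `K`
with coefficients of total absolute value at most 1 (`exists_odd_finite_combination`). Hence `P u`
has energy at most `c`, and continuity of the coefficients gives continuity in the energy norm. It
remains to return to the unit sphere of `L^{p(x)}` at little cost, that is, to know that `‖P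
u‖_{p(x)}` is close to 1.

This is an Ehrling-type inequality `‖u‖_{p(x)} ≤ η ‖∇u‖_{p(x)} + C ‖u‖_1`, with `η` arbitrarily
small (`luxNorm_le_interpolate`). Locally `p` is nearly constant, so the constant-exponent Sobolev
inequality gives integrability of a power above `p(x)`, which is interpolated with `L¹`; compactness
of `closure Ω` patches the local estimates together. Dividing `P u` by its norm then raises the
energy bound at most to `c (1 + κ)`, with `κ` arbitrary (`exists_mem_familyW0`). -/

/-- The exponent `p` is measurable on the measurable set `Ω`, with values in `[1, b]`. -/
structure BoundedExponent (Ω : Set (Euc N)) (p : Euc N → ℝ) (b : ℝ) : Prop where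
  measurableSet : MeasurableSet Ω
  aemeasurable : AEMeasurable p (volume.restrict Ω)
  one_le : ∀ x ∈ Ω, 1 ≤ p x
  le : ∀ x ∈ Ω, p x ≤ b

/-! ### Modulars and the Luxemburg norm -/

section Luxemburg

variable {F : Type*} [NormedAddCommGroup F] [NormedSpace ℝ F]
variable {Ω : Set (Euc N)} {p : Euc N → ℝ} {b : ℝ} {f g : Euc N → F}

theorem luxNorm_le {γ : ℝ} (hγ : 0 < γ) (h : modular Ω p (fun x => γ⁻¹ • f x) ≤ 1) :
    luxNorm Ω p f ≤ ENNReal.ofReal γ :=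
  iInf_le_of_le γ (iInf_le_of_le hγ (iInf_le_of_le h le_rfl))

namespace BoundedExponent

theorem modular_smul_le (hp : BoundedExponent Ω p b) {c : ℝ} (hc : ‖c‖ₑ ≤ 1) :
    modular Ω p (fun x => c • f x) ≤ ‖c‖ₑ * modular Ω p f := by
  rw [modular, modular, ← lintegral_const_mul' _ _ (by simp)]
  refine setLIntegral_mono' hp.measurableSet fun x hx => ?_
  have h1 := hp.one_le x hx
  rw [enorm_smul, ENNReal.mul_rpow_of_nonneg _ _ (by linarith)]
  gcongr
  simpa using ENNReal.rpow_le_rpow_of_exponent_ge hc h1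

theorem modular_smul_le_rpow (hp : BoundedExponent Ω p b) {c : ℝ} (hc : 1 ≤ ‖c‖ₑ) :
    modular Ω p (fun x => c • f x) ≤ ‖c‖ₑ ^ b * modular Ω p f := by
  have hc' : ‖c‖ₑ ≠ 0 := (zero_lt_one.trans_le hc).ne'
  rw [modular, modular, ← lintegral_const_mul' _ _ (ENNReal.rpow_ne_top_of_ne_zero hc' (by simp))]
  refine setLIntegral_mono' hp.measurableSet fun x hx => ?_
  have h1 := hp.one_le x hx
  rw [enorm_smul, ENNReal.mul_rpow_of_nonneg _ _ (by linarith)]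
  gcongr
  exact hp.le x hx

theorem modular_mono {F : Type*} [NormedAddCommGroup F] {f g : Euc N → F}
    (hp : BoundedExponent Ω p b) (h : ∀ x ∈ Ω, ‖f x‖ₑ ≤ ‖g x‖ₑ) :
    modular Ω p f ≤ modular Ω p g :=
  setLIntegral_mono' hp.measurableSet fun x hx =>
    ENNReal.rpow_le_rpow (h x hx) (by linarith [hp.one_le x hx])

/-- The strict inequality yields an admissible scale below `γ`, and the modular is monotone; no
attainment of the infimum is needed. -/
theorem modular_inv_smul_le_one (hp : BoundedExponent Ω p b) {γ : ℝ} (hγ : 0 < γ)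
    (h : luxNorm Ω p f < ENNReal.ofReal γ) : modular Ω p (fun x => γ⁻¹ • f x) ≤ 1 := by
  simp only [luxNorm, iInf_lt_iff] at h
  obtain ⟨γ', h0, h1, h2⟩ := h
  refine (hp.modular_mono fun x _ => ?_).trans h1
  rw [enorm_smul, enorm_smul]
  gcongr
  rw [Real.enorm_of_nonneg (by positivity), Real.enorm_of_nonneg (by positivity)]
  refine ENNReal.ofReal_le_ofReal ?_
  rw [ENNReal.ofReal_lt_ofReal_iff hγ] at h2
  gcongr

theorem luxNorm_zero (hp : BoundedExponent Ω p b) : luxNorm Ω p (fun _ => (0 : F)) = 0 := by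
  refine le_antisymm (ENNReal.le_of_forall_pos_le_add fun ε hε _ => ?_) bot_le
  rw [zero_add, ← ENNReal.ofReal_coe_nnreal]
  refine luxNorm_le (by exact_mod_cast hε) ?_
  have : modular Ω p (fun _ => (ε : ℝ)⁻¹ • (0 : F)) = ∫⁻ _ in Ω, 0 :=
    setLIntegral_congr_fun hp.measurableSet fun x hx => by
      have := hp.one_le x hx
      simp [ENNReal.zero_rpow_of_pos (show 0 < p x by linarith)]
  rw [this]; simp

theorem luxNorm_smul_le (hp : BoundedExponent Ω p b) (c : ℝ) :
    luxNorm Ω p (fun x => c • f x) ≤ ‖c‖ₑ * luxNorm Ω p f := by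
  rcases eq_or_ne c 0 with rfl | hc
  · simp [hp.luxNorm_zero]
  have hc0 : ‖c‖ₑ ≠ 0 := by simpa using hc
  simp only [luxNorm, ENNReal.mul_iInf_of_ne hc0 enorm_ne_top, le_iInf_iff]
  intro γ hγ h
  have hcp : 0 < |c| := abs_pos.2 hc
  have : ‖c‖ₑ * ENNReal.ofReal γ = ENNReal.ofReal (|c| * γ) := by
    rw [ENNReal.ofReal_mul hcp.le, Real.enorm_eq_ofReal_abs]
  rw [this]
  refine luxNorm_le (by positivity) (le_of_eq_of_le (modular_congr (ae_of_all _ fun x => ?_)) h)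
  rw [smul_smul, enorm_smul, enorm_smul]
  congr 1
  rw [Real.enorm_eq_ofReal_abs, Real.enorm_eq_ofReal_abs, abs_mul, abs_inv, abs_mul, abs_abs,
    abs_inv]
  congr 1
  field_simp

theorem luxNorm_smul (hp : BoundedExponent Ω p b) (c : ℝ) :
    luxNorm Ω p (fun x => c • f x) = ‖c‖ₑ * luxNorm Ω p f := by
  rcases eq_or_ne c 0 with rfl | hc
  · simp [hp.luxNorm_zero]
  have hc0 : ‖c‖ₑ ≠ 0 := by simpa using hc
  refine (hp.luxNorm_smul_le c).antisymm ?_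
  have h := hp.luxNorm_smul_le (f := fun x => c • f x) c⁻¹
  simp only [inv_smul_smul₀ hc] at h
  calc ‖c‖ₑ * luxNorm Ω p f ≤ ‖c‖ₑ * (‖c⁻¹‖ₑ * luxNorm Ω p fun x => c • f x) := by gcongr
    _ = luxNorm Ω p fun x => c • f x := by
      rw [enorm_inv hc, ← mul_assoc, ENNReal.mul_inv_cancel hc0 enorm_ne_top, one_mul]

theorem luxNorm_lt_top (hp : BoundedExponent Ω p b) (h : modular Ω p f < ⊤) :
    luxNorm Ω p f < ⊤ := by
  -- As `γ ≥ 1` and `p ≥ 1`, the modular of `f / γ` is at most that of `f` divided by `γ`, hence at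
  -- most 1.
  set γ : ℝ := max 1 (modular Ω p f).toReal with hγ
  have h1 : 1 ≤ γ := le_max_left _ _
  have h0 : 0 < γ := by linarith
  have he : ‖γ⁻¹‖ₑ = (ENNReal.ofReal γ)⁻¹ := by
    rw [enorm_inv h0.ne', Real.enorm_of_nonneg h0.le]
  refine (luxNorm_le h0 ?_).trans_lt ENNReal.ofReal_lt_top
  refine (hp.modular_smul_le ?_).trans ?_
  · rw [he, ENNReal.inv_le_one]
    simpa using h1
  · rw [he, mul_comm, ← div_eq_mul_inv]
    refine ENNReal.div_le_of_le_mul ?_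
    rw [one_mul]
    exact (ENNReal.ofReal_toReal h.ne).symm.le.trans (ENNReal.ofReal_le_ofReal (le_max_right _ _))

/-- Write `f = γ (f / γ)` and use `γ ^ p x ≤ γ ^ b`. This turns norm bounds into modular bounds, the
form in which Sobolev's inequality is applied. -/
theorem modular_le_of_luxNorm_lt (hp : BoundedExponent Ω p b) {γ : ℝ} (hγ : 1 ≤ γ)
    (h : luxNorm Ω p f < ENNReal.ofReal γ) : modular Ω p f ≤ ENNReal.ofReal γ ^ b := by
  have h0 : 0 < γ := by linarith
  have h1 := hp.modular_inv_smul_le_one h0 h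
  have he : ‖γ‖ₑ = ENNReal.ofReal γ := Real.enorm_of_nonneg h0.le
  have h2 := hp.modular_smul_le_rpow (f := fun x => γ⁻¹ • f x) (c := γ)
    (by rw [he]; simpa using hγ)
  simp only [smul_inv_smul₀ h0.ne', he] at h2
  exact h2.trans (mul_le_of_le_one_right' h1)

theorem modular_lt_top (hp : BoundedExponent Ω p b) (h : luxNorm Ω p f < ⊤) :
    modular Ω p f < ⊤ := by
  obtain ⟨γ, hγ⟩ := ENNReal.lt_iff_exists_nnreal_btwn.1 h
  have h1 : (1 : ℝ) ≤ max 1 (γ : ℝ) := le_max_left _ _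
  refine (hp.modular_le_of_luxNorm_lt h1 (hγ.1.trans_le ?_)).trans_lt ?_
  · rw [← ENNReal.ofReal_coe_nnreal]
    exact ENNReal.ofReal_le_ofReal (le_max_right _ _)
  · refine lt_top_iff_ne_top.2 (ENNReal.rpow_ne_top_of_ne_zero ?_ ENNReal.ofReal_ne_top)
    simp

/-- For `s > ‖f‖` and `t > ‖g‖`, the quotient `(f + g) / (s + t)` is the convex combination of `f /
s` and `g / t` with weights `s / (s + t)` and `t / (s + t)`; convexity of `r ↦ r ^ p x` bounds its
modular by 1. -/
theorem luxNorm_add_le (hp : BoundedExponent Ω p b)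
    (hf : AEStronglyMeasurable f (volume.restrict Ω)) :
    luxNorm Ω p (fun x => f x + g x) ≤ luxNorm Ω p f + luxNorm Ω p g := by
  rcases eq_or_ne (luxNorm Ω p f) ⊤ with hft | hft
  · simp [hft]
  rcases eq_or_ne (luxNorm Ω p g) ⊤ with hgt | hgt
  · simp [hgt]
  refine ENNReal.le_of_forall_pos_le_add fun ε hε _ => ?_
  have hε' : (0 : ℝ) < ε := hε
  set s := (luxNorm Ω p f).toReal + ε / 2
  set t := (luxNorm Ω p g).toReal + ε / 2
  have hs : 0 < s := by positivity
  have ht : 0 < t := by positivity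
  have key : ∀ {x : ℝ≥0∞}, x ≠ ⊤ → x < ENNReal.ofReal (x.toReal + ε / 2) := fun {x} hx => by
    conv_lhs => rw [← ENNReal.ofReal_toReal hx]
    rw [ENNReal.ofReal_lt_ofReal_iff (by positivity)]
    linarith
  have h1 := hp.modular_inv_smul_le_one hs (key hft)
  have h2 := hp.modular_inv_smul_le_one ht (key hgt)
  have hst : ENNReal.ofReal (s + t) = luxNorm Ω p f + luxNorm Ω p g + ε := by
    rw [show s + t = ((luxNorm Ω p f).toReal + (luxNorm Ω p g).toReal) + ε by ring,
      ENNReal.ofReal_add (by positivity) hε'.le, ENNReal.ofReal_add (by positivity) (by positivity),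
      ENNReal.ofReal_toReal hft, ENNReal.ofReal_toReal hgt, ENNReal.ofReal_coe_nnreal]
  rw [← hst]
  refine luxNorm_le (by positivity) ?_
  have hw1 : 0 ≤ s / (s + t) := by positivity
  have hw2 : 0 ≤ t / (s + t) := by positivity
  have hw : ENNReal.ofReal (s / (s + t)) + ENNReal.ofReal (t / (s + t)) = 1 := by
    rw [← ENNReal.ofReal_add hw1 hw2, ← add_div, div_self (by positivity), ENNReal.ofReal_one]
  calc modular Ω p (fun x => (s + t)⁻¹ • (f x + g x))
      ≤ ∫⁻ x in Ω, (ENNReal.ofReal (s / (s + t)) * ‖s⁻¹ • f x‖ₑ ^ p x +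
          ENNReal.ofReal (t / (s + t)) * ‖t⁻¹ • g x‖ₑ ^ p x) := by
        refine setLIntegral_mono' hp.measurableSet fun x hx => ?_
        have hx1 := hp.one_le x hx
        refine le_trans ?_ (ENNReal.rpow_arith_mean_le_arith_mean2_rpow _ _ _ _ hw hx1)
        refine ENNReal.rpow_le_rpow ?_ (by linarith)
        rw [← Real.enorm_of_nonneg hw1, ← Real.enorm_of_nonneg hw2, ← enorm_smul, ← enorm_smul,
          smul_smul, smul_smul]
        refine le_of_eq_of_le ?_ (enorm_add_le _ _)
        simp only [smul_add]
        congr 3 <;> field_simp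
    _ = ENNReal.ofReal (s / (s + t)) * modular Ω p (fun x => s⁻¹ • f x) +
          ENNReal.ofReal (t / (s + t)) * modular Ω p (fun x => t⁻¹ • g x) := by
        rw [lintegral_add_left', lintegral_const_mul' _ _ ENNReal.ofReal_ne_top,
          lintegral_const_mul' _ _ ENNReal.ofReal_ne_top]
        · rfl
        · exact ((hf.const_smul s⁻¹).enorm.pow hp.aemeasurable).const_mul _
    _ ≤ ENNReal.ofReal (s / (s + t)) * 1 + ENNReal.ofReal (t / (s + t)) * 1 := by gcongr
    _ = 1 := by simpa using hw

/-- Integrate the pointwise bound `r ≤ 1 + r ^ p x` at `r = ‖f x‖ / γ` for each admissible `γ`. -/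
theorem lintegral_enorm_le (hp : BoundedExponent Ω p b) (hΩ : volume Ω ≠ ⊤) :
    ∫⁻ x in Ω, ‖f x‖ₑ ≤ (volume Ω + 1) * luxNorm Ω p f := by
  have h0 : volume Ω + 1 ≠ 0 := by simp
  simp only [luxNorm, ENNReal.mul_iInf_of_ne h0 (show volume Ω + 1 ≠ ⊤ by simp [hΩ]), le_iInf_iff]
  intro γ hγ h
  calc ∫⁻ x in Ω, ‖f x‖ₑ ≤ ∫⁻ x in Ω, ENNReal.ofReal γ * (1 + ‖γ⁻¹ • f x‖ₑ ^ p x) := by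
        refine setLIntegral_mono' hp.measurableSet fun x hx => ?_
        have e : ‖f x‖ₑ = ENNReal.ofReal γ * ‖γ⁻¹ • f x‖ₑ := by
          rw [← Real.enorm_of_nonneg hγ.le, ← enorm_smul, smul_inv_smul₀ hγ.ne']
        rw [e]
        gcongr
        rcases le_total ‖γ⁻¹ • f x‖ₑ 1 with h1 | h1
        · exact h1.trans le_self_add
        · refine le_trans ?_ le_add_self
          simpa using ENNReal.rpow_le_rpow_of_exponent_le h1 (hp.one_le x hx)
    _ = ENNReal.ofReal γ * (volume Ω + modular Ω p (fun x => γ⁻¹ • f x)) := by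
        rw [lintegral_const_mul' _ _ ENNReal.ofReal_ne_top, lintegral_add_left measurable_const]
        simp [modular]
    _ ≤ ENNReal.ofReal γ * (volume Ω + 1) := by gcongr
    _ = _ := mul_comm _ _

end BoundedExponent

end Luxemburg

/-! ### Weak gradients, and the energy as an extended seminorm -/

section WeakGradient

variable {Ω : Set (Euc N)} {p : Euc N → ℝ} {b : ℝ}

theorem gradient_fun_add {φ ψ : Euc N → ℝ} {x : Euc N} (hφ : DifferentiableAt ℝ φ x)
    (hψ : DifferentiableAt ℝ ψ x) :
    gradient (fun y => φ y + ψ y) x = gradient φ x + gradient ψ x := by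
  simp [gradient, fderiv_fun_add hφ hψ]

theorem gradient_fun_const_smul {φ : Euc N → ℝ} {x : Euc N} (hφ : DifferentiableAt ℝ φ x) (c : ℝ) :
    gradient (fun y => c • φ y) x = c • gradient φ x := by
  rw [gradient, gradient, fderiv_fun_const_smul hφ, map_smul]

theorem norm_gradient (φ : Euc N → ℝ) (x : Euc N) : ‖gradient φ x‖ = ‖fderiv ℝ φ x‖ := by
  simp [gradient]

namespace IsTestFunction

variable {φ ψ : Euc N → ℝ}

theorem differentiable (h : IsTestFunction Ω φ) : Differentiable ℝ φ :=
  h.1.differentiable (by simp)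

theorem continuous_gradient (h : IsTestFunction Ω φ) : Continuous (gradient φ) :=
  (InnerProductSpace.toDual ℝ (Euc N)).symm.continuous.comp (h.1.continuous_fderiv (by simp))

theorem gradient_eq_zero {x : Euc N} (hx : x ∉ tsupport φ) : gradient φ x = 0 := by
  have : fderiv ℝ φ x = 0 :=
    image_eq_zero_of_notMem_tsupport fun h => hx (tsupport_fderiv_subset ℝ h)
  simp [gradient, this]

theorem add (h : IsTestFunction Ω φ) (h' : IsTestFunction Ω ψ) :
    IsTestFunction Ω (fun x => φ x + ψ x) :=
  ⟨h.1.add h'.1, h.2.1.add h'.2.1, (tsupport_add φ ψ).trans (union_subset h.2.2 h'.2.2)⟩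

theorem const_smul (h : IsTestFunction Ω φ) (c : ℝ) : IsTestFunction Ω (fun x => c • φ x) :=
  ⟨h.1.const_smul c, h.2.1.smul_left (f := fun _ => c),
    (tsupport_smul_subset_right (fun _ => c) φ).trans h.2.2⟩

end IsTestFunction

theorem integrableOn_smul_of_tsupport_subset {F : Type*} [NormedAddCommGroup F] [NormedSpace ℝ F]
    {u : Euc N → ℝ} {h : Euc N → F} {K : Set (Euc N)} (hK : IsCompact K) (hKΩ : K ⊆ Ω)
    (hu : LocallyIntegrableOn u Ω) (hh : Continuous h) (h0 : ∀ x ∉ K, h x = 0) :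
    IntegrableOn (fun x => u x • h x) Ω := by
  have h1 : IntegrableOn (fun x => u x • h x) K :=
    (hu.integrableOn_compact_subset hKΩ hK).smul_continuousOn hh.continuousOn hK
  exact (h1.integrable_of_forall_notMem_eq_zero fun x hx => by simp [h0 x hx]).integrableOn

theorem integrableOn_smul_of_tsupport_subset' {F : Type*} [NormedAddCommGroup F] [NormedSpace ℝ F]
    {G : Euc N → F} {h : Euc N → ℝ} {K : Set (Euc N)} (hK : IsCompact K) (hKΩ : K ⊆ Ω)
    (hG : LocallyIntegrableOn G Ω) (hh : Continuous h) (h0 : ∀ x ∉ K, h x = 0) :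
    IntegrableOn (fun x => h x • G x) Ω := by
  have h1 : IntegrableOn (fun x => h x • G x) K :=
    (hG.integrableOn_compact_subset hKΩ hK).continuousOn_smul hh.continuousOn hK
  exact (h1.integrable_of_forall_notMem_eq_zero fun x hx => by simp [h0 x hx]).integrableOn

namespace IsWeakGrad

variable {u v : Euc N → ℝ} {G H : Euc N → Euc N}

theorem integrableOn_smul_gradient (h : IsWeakGrad Ω u G) {φ : Euc N → ℝ}
    (hφ : IsTestFunction Ω φ) : IntegrableOn (fun x => u x • gradient φ x) Ω :=
  integrableOn_smul_of_tsupport_subset hφ.2.1 hφ.2.2 h.1 hφ.continuous_gradient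
    fun _ hx => IsTestFunction.gradient_eq_zero hx

theorem integrableOn_smul (h : IsWeakGrad Ω u G) {φ : Euc N → ℝ}
    (hφ : IsTestFunction Ω φ) : IntegrableOn (fun x => φ x • G x) Ω :=
  integrableOn_smul_of_tsupport_subset' hφ.2.1 hφ.2.2 h.2.1 hφ.1.continuous
    fun _ hx => image_eq_zero_of_notMem_tsupport hx

/-- The fundamental lemma of the calculus of variations. It frees the energy from the arbitrary
choice made in `weakGrad`. -/
theorem ae_eq (hΩ : IsOpen Ω) (h : IsWeakGrad Ω u G) (h' : IsWeakGrad Ω u H) :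
    G =ᵐ[volume.restrict Ω] H := by
  have key : ∀ᵐ x, x ∈ Ω → G x - H x = 0 := by
    refine hΩ.ae_eq_zero_of_integral_contDiff_smul_eq_zero (h.2.1.sub h'.2.1) fun φ h1 h2 h3 => ?_
    have hφ : IsTestFunction Ω φ := ⟨h1, h2, h3⟩
    have e := (h.2.2 φ hφ).symm.trans (h'.2.2 φ hφ)
    rw [← setIntegral_eq_integral_of_forall_compl_eq_zero (s := Ω) fun x hx => ?_]
    · simp only [smul_sub]
      rw [integral_sub (h.integrableOn_smul hφ) (h'.integrableOn_smul hφ), neg_inj.1 e, sub_self]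
    · rw [image_eq_zero_of_notMem_tsupport fun hx' => hx (h3 hx'), zero_smul]
  rw [Filter.EventuallyEq, ae_restrict_iff' hΩ.measurableSet]
  exact key.mono fun x hx hxΩ => sub_eq_zero.1 (hx hxΩ)

theorem add (h : IsWeakGrad Ω u G) (h' : IsWeakGrad Ω v H) :
    IsWeakGrad Ω (fun x => u x + v x) (fun x => G x + H x) := by
  refine ⟨h.1.add h'.1, h.2.1.add h'.2.1, fun φ hφ => ?_⟩
  simp only [add_smul, smul_add]
  rw [integral_add (h.integrableOn_smul_gradient hφ) (h'.integrableOn_smul_gradient hφ),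
    integral_add (h.integrableOn_smul hφ) (h'.integrableOn_smul hφ), h.2.2 φ hφ, h'.2.2 φ hφ]
  abel

theorem const_smul (h : IsWeakGrad Ω u G) (c : ℝ) :
    IsWeakGrad Ω (fun x => c • u x) (fun x => c • G x) := by
  refine ⟨h.1.smul c, h.2.1.smul c, fun φ hφ => ?_⟩
  simp only [smul_assoc, smul_comm _ c (_ : Euc N)]
  rw [integral_smul, integral_smul, h.2.2 φ hφ, smul_neg]

end IsWeakGrad

theorem locallyIntegrableOn_congr_ae {u v : Euc N → ℝ}
    (hu : LocallyIntegrableOn u Ω) (h : u =ᵐ[volume.restrict Ω] v) : LocallyIntegrableOn v Ω := by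
  intro x hx
  obtain ⟨s, hs, hi⟩ := hu x hx
  refine ⟨s ∩ Ω, Filter.inter_mem hs self_mem_nhdsWithin, ?_⟩
  exact (hi.mono_set inter_subset_left).congr_fun_ae (ae_restrict_of_ae_restrict_of_subset
    inter_subset_right h)

/-- `u` belongs to `W_0^{1,p(x)}(Ω)` and `G` is its distributional gradient. -/
structure IsW0Pair (Ω : Set (Euc N)) (p : Euc N → ℝ) (u : Euc N → ℝ) (G : Euc N → Euc N) :
    Prop where
  memLpx : MemLpx Ω p u
  isWeakGrad : IsWeakGrad Ω u G
  memLpx_grad : MemLpx Ω p G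
  approx : ∀ ε : ℝ≥0∞, 0 < ε → ∃ φ : Euc N → ℝ, IsTestFunction Ω φ ∧
      luxNorm Ω p (fun x => u x - φ x) + luxNorm Ω p (fun x => G x - gradient φ x) < ε

theorem memW0_iff_exists_pair {u : Euc N → ℝ} : MemW0 Ω p u ↔ ∃ G, IsW0Pair Ω p u G :=
  ⟨fun ⟨h, G, h1, h2, h3⟩ => ⟨G, h, h1, h2, h3⟩, fun ⟨G, h, h1, h2, h3⟩ => ⟨h, G, h1, h2, h3⟩⟩

namespace MemLpx

variable {F : Type*} [NormedAddCommGroup F] [NormedSpace ℝ F] {f g : Euc N → F}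

theorem add (hp : BoundedExponent Ω p b) (hf : MemLpx Ω p f) (hg : MemLpx Ω p g) :
    MemLpx Ω p (fun x => f x + g x) :=
  ⟨hf.1.add hg.1, hp.modular_lt_top <| (hp.luxNorm_add_le hf.1).trans_lt <|
    ENNReal.add_lt_top.2 ⟨hp.luxNorm_lt_top hf.2, hp.luxNorm_lt_top hg.2⟩⟩

theorem const_smul (hp : BoundedExponent Ω p b) (hf : MemLpx Ω p f) (c : ℝ) :
    MemLpx Ω p (fun x => c • f x) :=
  ⟨hf.1.const_smul c, hp.modular_lt_top <| (hp.luxNorm_smul c).trans_lt <|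
    ENNReal.mul_lt_top (by simp) (hp.luxNorm_lt_top hf.2)⟩

end MemLpx

namespace IsW0Pair

variable {u v : Euc N → ℝ} {G H : Euc N → Euc N}

theorem add (hp : BoundedExponent Ω p b) (h : IsW0Pair Ω p u G) (h' : IsW0Pair Ω p v H) :
    IsW0Pair Ω p (fun x => u x + v x) (fun x => G x + H x) where
  memLpx := h.memLpx.add hp h'.memLpx
  isWeakGrad := h.isWeakGrad.add h'.isWeakGrad
  memLpx_grad := h.memLpx_grad.add hp h'.memLpx_grad
  approx ε hε := by
    obtain ⟨φ, hφ, h1⟩ := h.approx (ε / 2) (ENNReal.half_pos hε.ne')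
    obtain ⟨ψ, hψ, h2⟩ := h'.approx (ε / 2) (ENNReal.half_pos hε.ne')
    refine ⟨_, hφ.add hψ, ?_⟩
    have e1 : (fun x => u x + v x - (φ x + ψ x)) = fun x => (u x - φ x) + (v x - ψ x) := by
      ext x; ring
    have e2 : (fun x => G x + H x - gradient (fun y => φ y + ψ y) x) =
        fun x => (G x - gradient φ x) + (H x - gradient ψ x) := by
      funext x; rw [gradient_fun_add (hφ.differentiable x) (hψ.differentiable x)]; abel
    rw [e1, e2]
    refine (add_le_add (hp.luxNorm_add_le (h.memLpx.1.sub hφ.1.continuous.aestronglyMeasurable))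
      (hp.luxNorm_add_le
        (h.memLpx_grad.1.sub hφ.continuous_gradient.aestronglyMeasurable))).trans_lt ?_
    rw [add_add_add_comm]
    exact (ENNReal.add_lt_add h1 h2).trans_eq (ENNReal.add_halves ε)

theorem const_smul (hp : BoundedExponent Ω p b) (h : IsW0Pair Ω p u G) (c : ℝ) :
    IsW0Pair Ω p (fun x => c • u x) (fun x => c • G x) where
  memLpx := h.memLpx.const_smul hp c
  isWeakGrad := h.isWeakGrad.const_smul c
  memLpx_grad := h.memLpx_grad.const_smul hp c
  approx ε hε := by
    obtain ⟨δ, hδ, hδε⟩ : ∃ δ : ℝ≥0∞, 0 < δ ∧ ‖c‖ₑ * δ < ε := by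
      -- The minimum with 1 keeps `δ` finite when `ε = ⊤`; the summand 1 in the denominator covers
      -- `c = 0`.
      refine ⟨min (ε / 2) 1 / (‖c‖ₑ + 1), ENNReal.div_pos (by simp [hε.ne']) (by simp), ?_⟩
      rcases eq_or_ne ε ⊤ with rfl | hε'
      · exact ENNReal.mul_lt_top (by simp) (ENNReal.div_lt_top (by simp) (by simp))
      calc ‖c‖ₑ * (min (ε / 2) 1 / (‖c‖ₑ + 1))
          ≤ (‖c‖ₑ + 1) * (min (ε / 2) 1 / (‖c‖ₑ + 1)) := by gcongr; exact le_self_add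
        _ = min (ε / 2) 1 := ENNReal.mul_div_cancel (by simp) (by simp)
        _ ≤ ε / 2 := min_le_left _ _
        _ < ε := ENNReal.half_lt_self hε.ne' hε'
    obtain ⟨φ, hφ, h1⟩ := h.approx δ hδ
    refine ⟨_, hφ.const_smul c, ?_⟩
    have e1 : (fun x => c • u x - c • φ x) = fun x => c • (u x - φ x) := by
      ext x; rw [smul_sub]
    have e2 : (fun x => c • G x - gradient (fun y => c • φ y) x) =
        fun x => c • (G x - gradient φ x) := by
      funext x; rw [gradient_fun_const_smul (hφ.differentiable x), smul_sub]
    rw [e1, e2, hp.luxNorm_smul, hp.luxNorm_smul, ← mul_add]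
    exact (mul_le_mul_right h1.le _).trans_lt hδε

/-- Sums and multiples in `L1 Ω` agree with the pointwise ones only almost everywhere; this passes
between the two. -/
theorem congr (h : IsW0Pair Ω p u G) (huv : u =ᵐ[volume.restrict Ω] v) :
    IsW0Pair Ω p v G where
  memLpx := ⟨h.memLpx.1.congr huv, by
    rw [← modular_congr (f := u) (huv.mono fun x hx => by rw [hx])]; exact h.memLpx.2⟩
  isWeakGrad := ⟨locallyIntegrableOn_congr_ae h.isWeakGrad.1 huv, h.isWeakGrad.2.1,
    fun φ hφ => by
      rw [← h.isWeakGrad.2.2 φ hφ]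
      exact integral_congr_ae (huv.mono fun x hx => by simp only [hx])⟩
  memLpx_grad := h.memLpx_grad
  approx ε hε := by
    obtain ⟨φ, hφ, h1⟩ := h.approx ε hε
    refine ⟨φ, hφ, ?_⟩
    rwa [← luxNorm_congr (f := fun x => u x - φ x) (huv.mono fun x hx => by simp only [hx])]

theorem gradNorm_eq (hΩ : IsOpen Ω) {u : L1 Ω} (h : IsW0Pair Ω p u G) :
    gradNorm Ω p u = luxNorm Ω p G := by
  have hex : ∃ G, IsWeakGrad Ω u G := ⟨G, h.isWeakGrad⟩
  rw [gradNorm, weakGrad, dif_pos hex]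
  exact luxNorm_congr ((hex.choose_spec.ae_eq hΩ h.isWeakGrad).mono fun x hx => by rw [hx])

theorem energy_eq (hΩ : IsOpen Ω) {u : L1 Ω} (h : IsW0Pair Ω p u G) :
    energy Ω p u = luxNorm Ω p G := by
  rw [energy, if_pos (memW0_iff_exists_pair.2 ⟨G, h⟩), h.gradNorm_eq hΩ]

end IsW0Pair

namespace BoundedExponent

variable {u v : L1 Ω}

theorem memW0_add (hp : BoundedExponent Ω p b) (hu : MemW0 Ω p u) (hv : MemW0 Ω p v) :
    MemW0 Ω p (u + v : L1 Ω) := by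
  obtain ⟨G, hG⟩ := memW0_iff_exists_pair.1 hu
  obtain ⟨H, hH⟩ := memW0_iff_exists_pair.1 hv
  exact memW0_iff_exists_pair.2 ⟨_, (hG.add hp hH).congr (Lp.coeFn_add u v).symm⟩

theorem memW0_smul (hp : BoundedExponent Ω p b) (hu : MemW0 Ω p u) (c : ℝ) :
    MemW0 Ω p (c • u : L1 Ω) := by
  obtain ⟨G, hG⟩ := memW0_iff_exists_pair.1 hu
  exact memW0_iff_exists_pair.2
    ⟨_, (hG.const_smul hp c).congr (Lp.coeFn_smul c u).symm⟩

theorem energy_add_le (hp : BoundedExponent Ω p b) (hΩ : IsOpen Ω) (u v : L1 Ω) :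
    energy Ω p (u + v) ≤ energy Ω p u + energy Ω p v := by
  by_cases hu : MemW0 Ω p u
  swap
  · simp [energy, hu]
  by_cases hv : MemW0 Ω p v
  swap
  · simp [energy, hv]
  obtain ⟨G, hG⟩ := memW0_iff_exists_pair.1 hu
  obtain ⟨H, hH⟩ := memW0_iff_exists_pair.1 hv
  rw [hG.energy_eq hΩ, hH.energy_eq hΩ,
    ((hG.add hp hH).congr (Lp.coeFn_add u v).symm).energy_eq hΩ]
  exact hp.luxNorm_add_le hG.memLpx_grad.1

theorem isTestFunction_zero : IsTestFunction Ω (fun _ => 0) :=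
  ⟨contDiff_const, HasCompactSupport.zero, by simp⟩

theorem isW0Pair_zero (hp : BoundedExponent Ω p b) :
    IsW0Pair Ω p (fun _ => 0) (fun _ => 0) where
  memLpx := ⟨aestronglyMeasurable_const, hp.modular_lt_top (by simp [hp.luxNorm_zero])⟩
  isWeakGrad := ⟨locallyIntegrableOn_zero, locallyIntegrableOn_zero, by simp⟩
  memLpx_grad := ⟨aestronglyMeasurable_const, hp.modular_lt_top (by simp [hp.luxNorm_zero])⟩
  approx ε hε := ⟨fun _ => 0, isTestFunction_zero, by
    have : ∀ x : Euc N, gradient (fun _ : Euc N => (0 : ℝ)) x = 0 := fun x => by simp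
    simpa [this, hp.luxNorm_zero] using hε⟩

theorem energy_zero (hp : BoundedExponent Ω p b) (hΩ : IsOpen Ω) :
    energy Ω p (0 : L1 Ω) = 0 := by
  rw [(hp.isW0Pair_zero.congr (Lp.coeFn_zero ℝ 1 _).symm).energy_eq hΩ,
    hp.luxNorm_zero]

theorem energy_smul (hp : BoundedExponent Ω p b) (hΩ : IsOpen Ω) (c : ℝ) (u : L1 Ω) :
    energy Ω p (c • u) = ‖c‖ₑ * energy Ω p u := by
  rcases eq_or_ne c 0 with rfl | hc
  · simp [hp.energy_zero hΩ]
  by_cases hu : MemW0 Ω p u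
  · obtain ⟨G, hG⟩ := memW0_iff_exists_pair.1 hu
    rw [hG.energy_eq hΩ,
      ((hG.const_smul hp c).congr (Lp.coeFn_smul c u).symm).energy_eq hΩ,
      hp.luxNorm_smul]
  · have hcu : ¬ MemW0 Ω p (c • u : L1 Ω) := fun h => hu <| by
      have := hp.memW0_smul h c⁻¹
      rwa [inv_smul_smul₀ hc] at this
    simp [energy, hu, hcu, ENNReal.mul_top, hc]

theorem energy_neg (hp : BoundedExponent Ω p b) (hΩ : IsOpen Ω) (u : L1 Ω) :
    energy Ω p (-u) = energy Ω p u := by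
  simpa using hp.energy_smul hΩ (-1) u

theorem convexOn_energy (hp : BoundedExponent Ω p b) (hΩ : IsOpen Ω) :
    ConvexOn ℝ≥0 univ (energy Ω p) := by
  refine ⟨convex_univ, fun u _ v _ s t _ _ _ => ?_⟩
  refine (hp.energy_add_le hΩ _ _).trans_eq ?_
  have key : ∀ (s : ℝ≥0) (u : L1 Ω), energy Ω p (s • u) = s • energy Ω p u := fun s u => by
    have : s • u = (s : ℝ) • u := rfl
    rw [this, hp.energy_smul hΩ, ENNReal.smul_def, smul_eq_mul]
    simp
  rw [key, key]

end BoundedExponent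

end WeakGradient

/-! ### Poincaré and Ehrling-type inequalities with variable exponent -/

section Sobolev

variable {Ω : Set (Euc N)} {p : Euc N → ℝ} {b : ℝ}

theorem _root_.ENNReal.le_of_forall_le_add_mul {a c : ℝ≥0∞} (K : ℝ≥0)
    (h : ∀ κ : ℝ≥0, 0 < κ → a ≤ c + K * κ) : a ≤ c := by
  refine ENNReal.le_of_forall_pos_le_add fun ε hε _ => (h (ε / (K + 1)) (by positivity)).trans ?_
  gcongr
  rw [← ENNReal.coe_mul]
  norm_cast
  rw [mul_div_assoc', div_le_iff₀ (by positivity), mul_comm]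
  gcongr
  exact le_self_add

theorem enorm_gradient (φ : Euc N → ℝ) (x : Euc N) : ‖gradient φ x‖ₑ = ‖fderiv ℝ φ x‖ₑ := by
  rw [← ofReal_norm, norm_gradient, ofReal_norm]

theorem enorm_fderiv_eq_zero {φ : Euc N → ℝ} {x : Euc N} (hx : x ∉ tsupport φ) :
    ‖fderiv ℝ φ x‖ₑ = 0 := by
  rw [← enorm_gradient, IsTestFunction.gradient_eq_zero hx, enorm_zero]

/-- Sobolev's inequality on a bounded set with both exponents equal to 1, which is subcritical
because `N ≥ 2`. -/
theorem exists_lintegral_le_lintegral_gradient (hN : 2 ≤ N) (hΩ : Bornology.IsBounded Ω) :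
    ∃ C : ℝ≥0, ∀ φ : Euc N → ℝ, IsTestFunction Ω φ →
      ∫⁻ x in Ω, ‖φ x‖ₑ ≤ C * ∫⁻ x in Ω, ‖gradient φ x‖ₑ := by
  refine ⟨eLpNormLESNormFDerivOfLeConst ℝ (volume : Measure (Euc N)) Ω 1 1, fun φ hφ => ?_⟩
  have hs : Function.support φ ⊆ Ω := (subset_tsupport φ).trans hφ.2.2
  have h := eLpNorm_le_eLpNorm_fderiv (volume : Measure (Euc N)) (hφ.1.of_le (by simp)) hs
    (p := 1) le_rfl (by rw [finrank_euclideanSpace_fin]; exact_mod_cast hN) hΩ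
  simp only [ENNReal.coe_one, eLpNorm_one_eq_lintegral_enorm, ← enorm_gradient] at h
  have hg : Function.support (fun x => ‖gradient φ x‖ₑ) ⊆ Ω := fun x hx => by
    by_contra hxΩ
    exact hx (by simp [IsTestFunction.gradient_eq_zero fun h' => hxΩ (hφ.2.2 h')])
  rw [setLIntegral_eq_of_support_subset hg]
  exact (setLIntegral_le_lintegral _ _).trans h

theorem rpow_le_one_add_rpow (t : ℝ≥0∞) {r s : ℝ} (hr : 0 ≤ r) (hrs : r ≤ s) :
    t ^ r ≤ 1 + t ^ s := by
  rcases le_total t 1 with h | h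
  · exact (ENNReal.rpow_le_one h hr).trans le_self_add
  · exact (ENNReal.rpow_le_rpow_of_exponent_le h hrs).trans le_add_self

/-- Split at `t = B`: below it `t ^ (s - 1) ≤ B ^ q`, above it `t ^ s ≤ t ^ (q - κ)` and `t ^ (-κ) ≤
B ^ (-κ)`. A large `B` makes the coefficient of the higher power small. -/
theorem rpow_le_interpolate {t B : ℝ≥0∞} (ht : t ≠ ⊤) (hB : 1 ≤ B) {q s κ : ℝ}
    (hs : 1 ≤ s) (hκ : 0 ≤ κ) (hsq : s ≤ q - κ) :
    t ^ s ≤ B ^ (-κ) * t ^ q + B ^ q * t := by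
  rcases eq_or_ne t 0 with rfl | h0
  · simp [ENNReal.zero_rpow_of_pos (show 0 < s by linarith)]
  rcases le_total t B with h | h
  · refine le_trans ?_ le_add_self
    calc t ^ s = t ^ (s - 1) * t := by
          conv_rhs => rw [← ENNReal.rpow_one t, ← ENNReal.rpow_mul, one_mul,
            ← ENNReal.rpow_add _ _ h0 ht]
          simp
      _ ≤ B ^ (s - 1) * t := by gcongr
      _ ≤ B ^ q * t := by gcongr; linarith
  · refine le_trans ?_ le_self_add
    calc t ^ s ≤ t ^ (-κ + q) := ENNReal.rpow_le_rpow_of_exponent_le (hB.trans h) (by linarith)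
      _ = t ^ (-κ) * t ^ q := ENNReal.rpow_add _ _ h0 ht
      _ ≤ B ^ (-κ) * t ^ q := by
        gcongr ?_ * _
        rw [ENNReal.rpow_neg, ENNReal.rpow_neg, ENNReal.inv_le_inv]
        gcongr

namespace BoundedExponent

/-- Since `r ≤ p` on the part of `Ω` meeting the support of `ψ`, modular bounds control `∇(ψ φ)` in
the constant-exponent space `L^r`. Sobolev's inequality then gains the fixed amount `1 / N` in the
exponent. -/
theorem exists_lintegral_rpow_mul_le (hp : BoundedExponent Ω p b) (hΩ : Bornology.IsBounded Ω)
    {ψ : Euc N → ℝ} (hψ : ContDiff ℝ ∞ ψ) (hψc : HasCompactSupport ψ) {r : ℝ≥0} (hr : 1 ≤ r)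
    (hrN : r < N) (hrp : ∀ x ∈ Ω, x ∈ tsupport ψ → r ≤ p x) (M : ℝ≥0) :
    ∃ A : ℝ≥0, ∀ φ : Euc N → ℝ, IsTestFunction Ω φ → modular Ω p φ ≤ M →
      modular Ω p (gradient φ) ≤ M →
      ∫⁻ x in Ω, ‖ψ x * φ x‖ₑ ^ ((r : ℝ) + (N : ℝ)⁻¹) ≤ A := by
  have hN : (0 : ℝ) < N := by
    have : (0 : ℝ≥0) < N := (zero_lt_one.trans_le hr).trans hrN
    exact_mod_cast this
  have hr' : (1 : ℝ) ≤ r := hr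
  have hr0 : r ≠ 0 := (zero_lt_one.trans_le hr).ne'
  set q : ℝ≥0 := r + (N : ℝ≥0)⁻¹ with hq
  have hqr : ((r : ℝ) + (N : ℝ)⁻¹) = (q : ℝ) := by simp [hq]
  have hq0 : q ≠ 0 := by positivity
  obtain ⟨D₁, hD₁⟩ := hψc.exists_bound_of_continuous hψ.continuous
  obtain ⟨D₂, hD₂⟩ := (hψc.fderiv ℝ).exists_bound_of_continuous (hψ.continuous_fderiv (by simp))
  set D : ℝ≥0∞ := ENNReal.ofReal (max D₁ D₂)
  have hDψ : ∀ x, ‖ψ x‖ₑ ≤ D := fun x => by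
    rw [← ofReal_norm]; exact ENNReal.ofReal_le_ofReal ((hD₁ x).trans (le_max_left _ _))
  have hDψ' : ∀ x, ‖fderiv ℝ ψ x‖ₑ ≤ D := fun x => by
    rw [← ofReal_norm]; exact ENNReal.ofReal_le_ofReal ((hD₂ x).trans (le_max_right _ _))
  set c := eLpNormLESNormFDerivOfLeConst ℝ (volume : Measure (Euc N)) Ω r q
  set A₀ : ℝ≥0∞ := D ^ (r : ℝ) * 2 ^ ((r : ℝ) - 1) * (2 * volume Ω + M + M)
  have hA₀ : A₀ ≠ ⊤ := by
    refine ENNReal.mul_ne_top (ENNReal.mul_ne_top ?_ ?_) ?_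
    · exact ENNReal.rpow_ne_top_of_nonneg (by linarith) ENNReal.ofReal_ne_top
    · exact ENNReal.rpow_ne_top_of_nonneg (by linarith) (by simp)
    · simp [ENNReal.mul_eq_top, hΩ.measure_lt_top.ne]
  have hA : ((c : ℝ≥0∞) * A₀ ^ (r : ℝ)⁻¹) ^ (q : ℝ) ≠ ⊤ :=
    ENNReal.rpow_ne_top_of_nonneg q.2 (ENNReal.mul_ne_top (by simp)
      (ENNReal.rpow_ne_top_of_nonneg (by positivity) hA₀))
  refine ⟨(((c : ℝ≥0∞) * A₀ ^ (r : ℝ)⁻¹) ^ (q : ℝ)).toNNReal, fun φ hφ hM hM' => ?_⟩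
  rw [ENNReal.coe_toNNReal hA, hqr]
  have hsm : ContDiff ℝ 1 (fun x => ψ x * φ x) := (hψ.mul hφ.1).of_le (by simp)
  have hsupp : Function.support (fun x => ψ x * φ x) ⊆ Ω := fun x hx =>
    hφ.2.2 (subset_tsupport φ (right_ne_zero_of_mul hx))
  -- The exponent `q = r + 1 / N` is admissible because `1 / r - 1 / q = (1 / N) / (r q) ≤ 1 / N`,
  -- as `r q ≥ 1`.
  have hsob := eLpNorm_le_eLpNorm_fderiv_of_le (volume : Measure (Euc N)) hsm hsupp
    (p := r) (q := q) hr (by rwa [finrank_euclideanSpace_fin]) (by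
      rw [finrank_euclideanSpace_fin, ← hqr]
      have h1 : 1 ≤ (r : ℝ) * (r + (N : ℝ)⁻¹) := by
        have : 0 < (N : ℝ)⁻¹ := by positivity
        nlinarith
      have h0 : (0 : ℝ) < r := by linarith
      have h2 : (0 : ℝ) < r + (N : ℝ)⁻¹ := by positivity
      push_cast
      have : (r : ℝ)⁻¹ - (r + (N : ℝ)⁻¹)⁻¹ = (N : ℝ)⁻¹ / (r * (r + (N : ℝ)⁻¹)) := by
        field_simp; ring
      have h3 : (N : ℝ)⁻¹ / (r * (r + (N : ℝ)⁻¹)) ≤ (N : ℝ)⁻¹ :=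
        div_le_self (by positivity) h1
      linarith) hΩ
  have hgrad : eLpNorm (fderiv ℝ fun x => ψ x * φ x) r volume ^ (r : ℝ) ≤ A₀ := by
    rw [eLpNorm_nnreal_pow_eq_lintegral hr0]
    have hzero : ∀ x, x ∉ tsupport φ → ‖fderiv ℝ (fun x => ψ x * φ x) x‖ₑ = 0 := fun x hx =>
      enorm_fderiv_eq_zero fun h => hx (tsupport_mul_subset_right h)
    have hzero' : ∀ x, x ∉ tsupport ψ → ‖fderiv ℝ (fun x => ψ x * φ x) x‖ₑ = 0 := fun x hx =>
      enorm_fderiv_eq_zero fun h => hx (tsupport_mul_subset_left h)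
    have hg : Function.support (fun x => ‖fderiv ℝ (fun x => ψ x * φ x) x‖ₑ ^ (r : ℝ)) ⊆ Ω := by
      intro x hx
      by_contra hxΩ
      refine hx ?_
      simp [hzero x fun h' => hxΩ (hφ.2.2 h'), zero_lt_one.trans_le hr]
    rw [← setLIntegral_eq_of_support_subset hg]
    calc ∫⁻ x in Ω, ‖fderiv ℝ (fun x => ψ x * φ x) x‖ₑ ^ (r : ℝ)
        ≤ ∫⁻ x in Ω, D ^ (r : ℝ) * 2 ^ ((r : ℝ) - 1) *
            (2 + ‖gradient φ x‖ₑ ^ p x + ‖φ x‖ₑ ^ p x) := by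
          refine setLIntegral_mono' hp.measurableSet fun x hx => ?_
          by_cases hxψ : x ∈ tsupport ψ
          swap
          · rw [hzero' x hxψ, ENNReal.zero_rpow_of_pos (by linarith)]
            exact bot_le
          have hrx := hrp x hx hxψ
          have h1 : ‖fderiv ℝ (fun x => ψ x * φ x) x‖ₑ ≤ D * (‖gradient φ x‖ₑ + ‖φ x‖ₑ) := by
            rw [fderiv_fun_mul (hψ.differentiable (by simp) x) (hφ.differentiable x)]
            refine (enorm_add_le (E := Euc N →L[ℝ] ℝ) _ _).trans ?_
            rw [enorm_smul, enorm_smul, mul_add, enorm_gradient, mul_comm ‖φ x‖ₑ]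
            gcongr
            exacts [hDψ x, hDψ' x]
          calc ‖fderiv ℝ (fun x => ψ x * φ x) x‖ₑ ^ (r : ℝ)
              ≤ (D * (‖gradient φ x‖ₑ + ‖φ x‖ₑ)) ^ (r : ℝ) := by gcongr
            _ = D ^ (r : ℝ) * (‖gradient φ x‖ₑ + ‖φ x‖ₑ) ^ (r : ℝ) :=
              ENNReal.mul_rpow_of_nonneg _ _ r.2
            _ ≤ D ^ (r : ℝ) * (2 ^ ((r : ℝ) - 1) *
                  (‖gradient φ x‖ₑ ^ (r : ℝ) + ‖φ x‖ₑ ^ (r : ℝ))) := by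
              gcongr
              exact ENNReal.rpow_add_le_mul_rpow_add_rpow _ _ hr
            _ ≤ D ^ (r : ℝ) * (2 ^ ((r : ℝ) - 1) *
                  ((1 + ‖gradient φ x‖ₑ ^ p x) + (1 + ‖φ x‖ₑ ^ p x))) := by
              gcongr <;> exact rpow_le_one_add_rpow _ r.2 hrx
            _ = _ := by
              rw [add_add_add_comm, one_add_one_eq_two, mul_assoc, add_assoc]
      _ = D ^ (r : ℝ) * 2 ^ ((r : ℝ) - 1) *
            (2 * volume Ω + modular Ω p (gradient φ) + modular Ω p φ) := by
          have hm : AEMeasurable (fun x => ‖gradient φ x‖ₑ ^ p x) (volume.restrict Ω) :=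
            hφ.continuous_gradient.aestronglyMeasurable.enorm.pow hp.aemeasurable
          rw [lintegral_const_mul', lintegral_add_left' (hm.const_add _),
            lintegral_add_left measurable_const]
          · simp [modular]
          · refine ENNReal.mul_ne_top ?_ ?_
            · exact ENNReal.rpow_ne_top_of_nonneg (by linarith) ENNReal.ofReal_ne_top
            · exact ENNReal.rpow_ne_top_of_nonneg (by linarith) (by simp)
      _ ≤ A₀ := mul_le_mul_right (by gcongr) _
  have hgrad' : eLpNorm (fderiv ℝ fun x => ψ x * φ x) r volume ≤ A₀ ^ (r : ℝ)⁻¹ := by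
    rw [ENNReal.le_rpow_inv_iff (by linarith)]
    exact hgrad
  refine (setLIntegral_le_lintegral _ _).trans ?_
  rw [← eLpNorm_nnreal_pow_eq_lintegral hq0]
  gcongr
  exact hsob.trans (by gcongr)

/-- On the part `s` of `Ω`, the modular of test functions with bounded energy is controlled by the
`L¹` norm up to an arbitrarily small error. -/
def HasModularInterpolation (Ω : Set (Euc N)) (p : Euc N → ℝ) (s : Set (Euc N)) : Prop :=
  ∀ M ε : ℝ≥0, 0 < ε → ∃ C : ℝ≥0, ∀ φ : Euc N → ℝ, IsTestFunction Ω φ → modular Ω p φ ≤ M →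
    modular Ω p (gradient φ) ≤ M →
    ∫⁻ x in Ω ∩ s, ‖φ x‖ₑ ^ p x ≤ ε + C * ∫⁻ x in Ω, ‖φ x‖ₑ

/-- Where `ψ` is supported, `p` stays at least `κ = 1 / (2N)` below the Sobolev exponent `q = r + 1
/ N`, so `rpow_le_interpolate` applies pointwise with that fixed gap. -/
theorem hasModularInterpolation_of_bump (hp : BoundedExponent Ω p b) (hΩ : Bornology.IsBounded Ω)
    {ψ : Euc N → ℝ} (hψ : ContDiff ℝ ∞ ψ) (hψc : HasCompactSupport ψ) {r : ℝ≥0} (hr : 1 ≤ r)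
    (hrN : r < N) (hrp : ∀ x ∈ Ω, x ∈ tsupport ψ → r ≤ p x ∧ p x ≤ r + (N : ℝ)⁻¹ / 2)
    {s : Set (Euc N)} (hs : MeasurableSet s) (hs1 : ∀ x ∈ s, ψ x = 1) :
    HasModularInterpolation Ω p s := by
  intro M ε hε
  have hN : (0 : ℝ) < N := by
    have : (0 : ℝ≥0) < N := (zero_lt_one.trans_le hr).trans hrN
    exact_mod_cast this
  obtain ⟨A, hA⟩ := hp.exists_lintegral_rpow_mul_le hΩ hψ hψc hr hrN
    (fun x hx hx' => (hrp x hx hx').1) M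
  set κ : ℝ := (N : ℝ)⁻¹ / 2 with hκ
  have hκ0 : 0 < κ := by positivity
  set q : ℝ := r + (N : ℝ)⁻¹ with hq
  have hq0 : 0 ≤ q := by positivity
  -- Chosen so that `B ^ (-κ) * A ≤ ε`.
  set B : ℝ≥0 := max 1 (A / ε) ^ κ⁻¹ with hB
  have hB1 : (1 : ℝ≥0) ≤ B := NNReal.one_le_rpow (le_max_left _ _) (by positivity)
  have hBA : B ^ (-κ) * A ≤ ε := by
    have h1 : B ^ κ = max 1 (A / ε) := by
      rw [hB, ← NNReal.rpow_mul, inv_mul_cancel₀ hκ0.ne', NNReal.rpow_one]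
    rw [NNReal.rpow_neg, h1, ← div_eq_inv_mul, div_le_iff₀ (by positivity), mul_comm,
      ← div_le_iff₀ hε]
    exact le_max_right _ _
  refine ⟨B ^ q, fun φ hφ hM hM' => ?_⟩
  have hBcoe : ((B ^ q : ℝ≥0) : ℝ≥0∞) = (B : ℝ≥0∞) ^ q := ENNReal.coe_rpow_of_nonneg _ hq0
  have hBcoe' : ((B ^ (-κ) : ℝ≥0) : ℝ≥0∞) = (B : ℝ≥0∞) ^ (-κ) :=
    ENNReal.coe_rpow_of_ne_zero (zero_lt_one.trans_le hB1).ne' _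
  calc ∫⁻ x in Ω ∩ s, ‖φ x‖ₑ ^ p x
      ≤ ∫⁻ x in Ω ∩ s, ((B : ℝ≥0∞) ^ (-κ) * ‖ψ x * φ x‖ₑ ^ q + (B : ℝ≥0∞) ^ q * ‖φ x‖ₑ) := by
        refine setLIntegral_mono' (hp.measurableSet.inter hs) fun x hx => ?_
        have hx1 : ψ x = 1 := hs1 x hx.2
        have hxt : x ∈ tsupport ψ := subset_tsupport ψ (by simp [hx1])
        rw [hx1, one_mul]
        exact rpow_le_interpolate (by simp) (by exact_mod_cast hB1) (hp.one_le x hx.1) hκ0.le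
          ((hrp x hx.1 hxt).2.trans (by rw [hq, hκ]; linarith))
    _ ≤ ∫⁻ x in Ω, ((B : ℝ≥0∞) ^ (-κ) * ‖ψ x * φ x‖ₑ ^ q + (B : ℝ≥0∞) ^ q * ‖φ x‖ₑ) :=
        lintegral_mono_set inter_subset_left
    _ = ((B : ℝ≥0∞) ^ (-κ) * ∫⁻ x in Ω, ‖ψ x * φ x‖ₑ ^ q) +
        (B : ℝ≥0∞) ^ q * ∫⁻ x in Ω, ‖φ x‖ₑ := by
        rw [← hBcoe, ← hBcoe', lintegral_add_right, lintegral_const_mul' _ _ (by simp),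
          lintegral_const_mul' _ _ (by simp)]
        exact (hφ.1.continuous.enorm.measurable).const_mul _
    _ ≤ _ := by
        rw [← hBcoe, ← hBcoe']
        gcongr
        calc ((B ^ (-κ) : ℝ≥0) : ℝ≥0∞) * ∫⁻ x in Ω, ‖ψ x * φ x‖ₑ ^ q
            ≤ ((B ^ (-κ) : ℝ≥0) : ℝ≥0∞) * A := by gcongr; exact hA φ hφ hM hM'
          _ ≤ ε := by exact_mod_cast hBA

theorem hasModularInterpolation_closure (hp : BoundedExponent Ω p b) (hbN : b < N)
    (hΩ : Bornology.IsBounded Ω) (hpc : ContinuousOn p (closure Ω)) :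
    HasModularInterpolation Ω p (closure Ω) := by
  refine hΩ.isCompact_closure.induction_on ?_ ?_ ?_ ?_
  · intro M ε _
    exact ⟨0, fun φ _ _ _ => by simp⟩
  · intro s t hst ht M ε hε
    obtain ⟨C, hC⟩ := ht M ε hε
    exact ⟨C, fun φ hφ h1 h2 =>
      (lintegral_mono_set (inter_subset_inter_right _ hst)).trans (hC φ hφ h1 h2)⟩
  · intro s t hs ht M ε hε
    obtain ⟨C, hC⟩ := hs M (ε / 2) (by positivity)
    obtain ⟨C', hC'⟩ := ht M (ε / 2) (by positivity)
    refine ⟨C + C', fun φ hφ h1 h2 => ?_⟩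
    rw [inter_union_distrib_left]
    refine (lintegral_union_le _ _ _).trans
      ((add_le_add (hC φ hφ h1 h2) (hC' φ hφ h1 h2)).trans_eq ?_)
    rw [add_add_add_comm, ← add_mul, ← ENNReal.coe_add, ← ENNReal.coe_add, add_halves]
  · intro x₀ hx₀
    obtain ⟨y₀, hy₀⟩ : Ω.Nonempty := closure_nonempty_iff.1 ⟨x₀, hx₀⟩
    have hN1 : (1 : ℝ) < N := ((hp.one_le y₀ hy₀).trans (hp.le y₀ hy₀)).trans_lt hbN
    have hN : (0 : ℝ) < N := by linarith
    obtain ⟨d, hd, hpd⟩ := Metric.continuousOn_iff.1 hpc x₀ hx₀ ((N : ℝ)⁻¹ / 4) (by positivity)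
    have hpd' : ∀ x ∈ Ω, dist x x₀ < d → |p x - p x₀| < (N : ℝ)⁻¹ / 4 := fun x hx hxd => by
      simpa [Real.dist_eq] using hpd x (subset_closure hx) hxd
    -- On the `d`-ball `p` varies by less than `1 / (4N)` from `p x₀`, so `r ≤ p ≤ r + 1 / (2N)`
    -- there within `Ω`. The maximum keeps `r` a legitimate Sobolev exponent.
    set r : ℝ := max 1 (p x₀ - (N : ℝ)⁻¹ / 4) with hr
    have hr1 : 1 ≤ r := le_max_left _ _
    have hrle : ∀ x ∈ Ω, dist x x₀ < d → r ≤ p x := fun x hx hxd =>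
      max_le (hp.one_le x hx) (by linarith [(abs_lt.1 (hpd' x hx hxd)).1])
    have hrN : r < N := by
      obtain ⟨y, hy, hyd⟩ := Metric.mem_closure_iff.1 hx₀ d hd
      rw [dist_comm] at hyd
      exact ((hrle y hy hyd).trans (hp.le y hy)).trans_lt hbN
    let ψ : ContDiffBump x₀ := ⟨d / 4, d / 2, by positivity, by linarith⟩
    refine ⟨Metric.ball x₀ (d / 4), mem_nhdsWithin_of_mem_nhds (Metric.ball_mem_nhds _ (by
      positivity)), ?_⟩
    refine hp.hasModularInterpolation_of_bump hΩ (ψ := ψ) ψ.contDiff ψ.hasCompactSupport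
      (r := ⟨r, by linarith⟩) (by exact_mod_cast hr1) ?_ (fun x hx hxψ => ?_)
      Metric.isOpen_ball.measurableSet (fun x hx => ?_)
    · exact NNReal.coe_lt_coe.1 (by rw [NNReal.coe_natCast]; exact hrN)
    · rw [ψ.tsupport_eq, Metric.mem_closedBall] at hxψ
      have hxd : dist x x₀ < d := hxψ.trans_lt (by change d / 2 < d; linarith)
      refine ⟨hrle x hx hxd, ?_⟩
      have h1 := (abs_lt.1 (hpd' x hx hxd)).2
      have h2 : p x₀ - (N : ℝ)⁻¹ / 4 ≤ r := le_max_right _ _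
      change p x ≤ r + (N : ℝ)⁻¹ / 2
      linarith
    · exact ψ.one_of_mem_closedBall (Metric.ball_subset_closedBall hx)

theorem modular_lt_top_of_bound (hp : BoundedExponent Ω p b) (hΩ : volume Ω ≠ ⊤)
    {F : Type*} [NormedAddCommGroup F] {f : Euc N → F} {D : ℝ} (hD : ∀ x, ‖f x‖ ≤ D) :
    modular Ω p f < ⊤ := by
  set D' : ℝ≥0∞ := ENNReal.ofReal (max 1 D)
  have hD1 : 1 ≤ D' := by simp [D']
  calc modular Ω p f ≤ ∫⁻ _ in Ω, D' ^ b := by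
        refine setLIntegral_mono' hp.measurableSet fun x hx => ?_
        have h1 := hp.one_le x hx
        have : ‖f x‖ₑ ≤ D' := by
          rw [← ofReal_norm]
          exact ENNReal.ofReal_le_ofReal ((hD x).trans (le_max_right _ _))
        exact (ENNReal.rpow_le_rpow this (by linarith)).trans
          (ENNReal.rpow_le_rpow_of_exponent_le hD1 (hp.le x hx))
    _ = D' ^ b * volume Ω := by simp
    _ < ⊤ := ENNReal.mul_lt_top (lt_top_iff_ne_top.2 (ENNReal.rpow_ne_top_of_ne_zero
        (zero_lt_one.trans_le hD1).ne' ENNReal.ofReal_ne_top)) (lt_top_iff_ne_top.2 hΩ)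

/-- The modular is not homogeneous, so the norm inequality is proved by contradiction after
rescaling: a counterexample of norm 2 would have modular both above and below 1. -/
theorem exists_luxNorm_le_of_isTestFunction (hp : BoundedExponent Ω p b)
    (hΩ : volume Ω ≠ ⊤) (hI : HasModularInterpolation Ω p (closure Ω)) {η : ℝ≥0}
    (hη : 0 < η) :
    ∃ C : ℝ≥0, ∀ φ : Euc N → ℝ, IsTestFunction Ω φ →
      luxNorm Ω p φ ≤ η * luxNorm Ω p (gradient φ) + C * ∫⁻ x in Ω, ‖φ x‖ₑ := by
  -- A common strict bound for the two norms after rescaling: `‖c φ‖ = 2 < 3`, and `‖c ∇φ‖ < 2 / η`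
  -- by the negated inequality.
  set γ : ℝ := max 3 (2 / η) with hγ
  have hγ3 : 3 ≤ γ := le_max_left _ _
  have hγ0 : ENNReal.ofReal γ ^ b ≠ ⊤ := ENNReal.rpow_ne_top_of_ne_zero
    (by simp; linarith) ENNReal.ofReal_ne_top
  obtain ⟨C, hC⟩ := hI (ENNReal.ofReal γ ^ b).toNNReal (1 / 2) (by positivity)
  rw [ENNReal.coe_toNNReal hγ0] at hC
  refine ⟨4 * C, fun φ hφ => ?_⟩
  by_contra! hlt
  obtain ⟨D, hD⟩ := hφ.2.1.exists_bound_of_continuous hφ.1.continuous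
  have hfin : luxNorm Ω p φ ≠ ⊤ := (hp.luxNorm_lt_top (hp.modular_lt_top_of_bound hΩ hD)).ne
  have hpos : luxNorm Ω p φ ≠ 0 := (bot_le.trans_lt hlt).ne'
  set l : ℝ := (luxNorm Ω p φ).toReal with hl
  have hl0 : 0 < l := ENNReal.toReal_pos hpos hfin
  have hll : ENNReal.ofReal l = luxNorm Ω p φ := ENNReal.ofReal_toReal hfin
  -- Norm 2 rather than 1 makes the modular strictly greater than 1. The factor 4 in the constant
  -- then leaves `C ‖c φ‖_1 < 1 / 2`, and `1 / 2` is also the interpolation error.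
  set c : ℝ := 2 / l with hc
  have hc0 : 0 < c := by positivity
  have hce : ‖c‖ₑ = 2 / luxNorm Ω p φ := by
    rw [Real.enorm_of_nonneg hc0.le, hc, ENNReal.ofReal_div_of_pos hl0, hll]; simp
  have hce' : ‖c‖ₑ * luxNorm Ω p φ = 2 := by
    rw [hce, ENNReal.div_mul_cancel hpos hfin]
  have hlux : luxNorm Ω p (fun x => c • φ x) = 2 := by rw [hp.luxNorm_smul, hce']
  have hgr : gradient (fun x => c • φ x) = fun x => c • gradient φ x := by
    funext x; exact gradient_fun_const_smul (hφ.differentiable x) c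
  have hmul : ‖c‖ₑ * (η * luxNorm Ω p (gradient φ) + (4 * C : ℝ≥0) * ∫⁻ x in Ω, ‖φ x‖ₑ) < 2 := by
    refine lt_of_lt_of_eq ?_ hce'
    exact ENNReal.mul_lt_mul_right (by simp [hc0.ne']) (by simp) hlt
  rw [mul_add] at hmul
  have hluxg : luxNorm Ω p (gradient fun x => c • φ x) < ENNReal.ofReal γ := by
    rw [hgr, hp.luxNorm_smul]
    have h1 : ‖c‖ₑ * luxNorm Ω p (gradient φ) * η < 2 := by
      refine lt_of_le_of_lt ?_ hmul
      rw [mul_assoc, mul_comm _ (η : ℝ≥0∞)]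
      exact le_self_add
    have h2 : ‖c‖ₑ * luxNorm Ω p (gradient φ) < 2 / η :=
      ENNReal.lt_div_iff_mul_lt (by simp [hη.ne']) (by simp) |>.2 h1
    refine h2.trans_le ?_
    have : (2 : ℝ≥0∞) / η = ENNReal.ofReal (2 / η) := by
      rw [ENNReal.ofReal_div_of_pos (by exact_mod_cast hη)]; simp
    rw [this]
    exact ENNReal.ofReal_le_ofReal (le_max_right _ _)
  have hmod := hC _ (hφ.const_smul c)
    (hp.modular_le_of_luxNorm_lt (by linarith) (by
      rw [hlux, ← ENNReal.ofReal_ofNat, ENNReal.ofReal_lt_ofReal_iff (by linarith)]; linarith))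
    (hp.modular_le_of_luxNorm_lt (by linarith) hluxg)
  rw [inter_eq_left.2 subset_closure] at hmod
  have hone : 1 < modular Ω p (fun x => c • φ x) := by
    by_contra! h
    have : luxNorm Ω p (fun x => c • φ x) ≤ ENNReal.ofReal 1 :=
      luxNorm_le one_pos (by simpa using h)
    rw [hlux] at this
    norm_num at this
  have hint : ∫⁻ x in Ω, ‖c • φ x‖ₑ = ‖c‖ₑ * ∫⁻ x in Ω, ‖φ x‖ₑ := by
    simp only [enorm_smul]
    exact lintegral_const_mul' _ _ (by simp)
  rw [hint] at hmod
  have hsmall : C * (‖c‖ₑ * ∫⁻ x in Ω, ‖φ x‖ₑ) < 1 / 2 := by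
    have h1 : 4 * (C * (‖c‖ₑ * ∫⁻ x in Ω, ‖φ x‖ₑ)) < 4 * (1 / 2) := by
      have e : (4 : ℝ≥0∞) * (1 / 2) = 2 := by
        rw [show (4 : ℝ≥0∞) = 2 * 2 by norm_num, mul_assoc, ENNReal.mul_div_cancel] <;> simp
      rw [e]
      refine lt_of_le_of_lt ?_ hmul
      refine le_trans (le_of_eq ?_) le_add_self
      push_cast
      ring
    exact lt_of_mul_lt_mul_left' h1
  have : modular Ω p (fun x => c • φ x) < 1 :=
    calc _ ≤ _ := hmod
      _ < ((1 / 2 : ℝ≥0) : ℝ≥0∞) + 1 / 2 := ENNReal.add_lt_add_left (by simp) hsmall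
      _ = 1 := by
        rw [ENNReal.coe_div (by simp)]
        simp [ENNReal.inv_two_add_inv_two]
  exact lt_asymm hone this

theorem lintegral_le_luxNorm (hp : BoundedExponent Ω p b) (hN : 2 ≤ N)
    (hΩ : Bornology.IsBounded Ω) :
    ∃ C : ℝ≥0, ∀ (u : Euc N → ℝ) (G : Euc N → Euc N), IsW0Pair Ω p u G →
      ∫⁻ x in Ω, ‖u x‖ₑ ≤ C * luxNorm Ω p G := by
  obtain ⟨C, hC⟩ := exists_lintegral_le_lintegral_gradient hN hΩ
  have hV : volume Ω ≠ ⊤ := hΩ.measure_lt_top.ne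
  set V : ℝ≥0 := (volume Ω + 1).toNNReal
  have hVe : (V : ℝ≥0∞) = volume Ω + 1 := ENNReal.coe_toNNReal (by simp [hV])
  refine ⟨C * V, fun u G h => ENNReal.le_of_forall_le_add_mul (C * V + V) fun κ hκ => ?_⟩
  obtain ⟨φ, hφ, hlt⟩ := h.approx κ (by exact_mod_cast hκ)
  have h1 : ∫⁻ x in Ω, ‖u x‖ₑ ≤ (∫⁻ x in Ω, ‖φ x‖ₑ) + ∫⁻ x in Ω, ‖u x - φ x‖ₑ := by
    rw [← lintegral_add_left hφ.1.continuous.enorm.measurable]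
    refine lintegral_mono fun x => ?_
    simpa using enorm_add_le (φ x) (u x - φ x)
  have h2 : ∫⁻ x in Ω, ‖gradient φ x‖ₑ ≤
      (∫⁻ x in Ω, ‖G x‖ₑ) + ∫⁻ x in Ω, ‖G x - gradient φ x‖ₑ := by
    rw [← lintegral_add_left' h.memLpx_grad.1.enorm]
    refine lintegral_mono fun x => ?_
    simpa using enorm_sub_le (E := Euc N) (a := G x) (b := G x - gradient φ x)
  calc ∫⁻ x in Ω, ‖u x‖ₑ ≤ C * ((∫⁻ x in Ω, ‖G x‖ₑ) + ∫⁻ x in Ω, ‖G x - gradient φ x‖ₑ) +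
        ∫⁻ x in Ω, ‖u x - φ x‖ₑ := h1.trans (by gcongr; exact (hC φ hφ).trans (by gcongr))
    _ ≤ C * (V * luxNorm Ω p G + V * κ) + V * κ := by
        rw [hVe]
        gcongr
        · exact hp.lintegral_enorm_le hV
        · exact (hp.lintegral_enorm_le hV).trans (by gcongr; exact le_add_self.trans hlt.le)
        · exact (hp.lintegral_enorm_le hV).trans (by gcongr; exact le_self_add.trans hlt.le)
    _ = _ := by push_cast; ring

/-- The estimate for test functions passes to their closure: an approximation within `κ` costs a
fixed multiple of `κ`, by the triangle inequality and the embedding of `L^{p(x)}` in `L¹`. -/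
theorem luxNorm_le_interpolate (hp : BoundedExponent Ω p b) (hbN : b < N)
    (hΩ : Bornology.IsBounded Ω) (hpc : ContinuousOn p (closure Ω)) {η : ℝ≥0} (hη : 0 < η) :
    ∃ C : ℝ≥0, ∀ (u : Euc N → ℝ) (G : Euc N → Euc N), IsW0Pair Ω p u G →
      luxNorm Ω p u ≤ η * luxNorm Ω p G + C * ∫⁻ x in Ω, ‖u x‖ₑ := by
  have hV : volume Ω ≠ ⊤ := hΩ.measure_lt_top.ne
  obtain ⟨C, hC⟩ := hp.exists_luxNorm_le_of_isTestFunction hV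
    (hp.hasModularInterpolation_closure hbN hΩ hpc) hη
  set V : ℝ≥0 := (volume Ω + 1).toNNReal
  have hVe : (V : ℝ≥0∞) = volume Ω + 1 := ENNReal.coe_toNNReal (by simp [hV])
  refine ⟨C, fun u G h => ENNReal.le_of_forall_le_add_mul (η + C * V + 1) fun κ hκ => ?_⟩
  obtain ⟨φ, hφ, hlt⟩ := h.approx κ (by exact_mod_cast hκ)
  have hκ1 : luxNorm Ω p (fun x => u x - φ x) ≤ κ := le_self_add.trans hlt.le
  have hκ2 : luxNorm Ω p (fun x => G x - gradient φ x) ≤ κ := le_add_self.trans hlt.le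
  have h1 : luxNorm Ω p u ≤ luxNorm Ω p φ + luxNorm Ω p (fun x => u x - φ x) := by
    have := hp.luxNorm_add_le (f := φ) (g := fun x => u x - φ x)
      hφ.1.continuous.aestronglyMeasurable
    simpa using this
  have h2 : luxNorm Ω p (gradient φ) ≤
      luxNorm Ω p G + luxNorm Ω p (fun x => G x - gradient φ x) := by
    have := hp.luxNorm_add_le (f := G) (g := fun x => gradient φ x - G x) h.memLpx_grad.1
    rw [luxNorm_congr (f := fun x => G x - gradient φ x) (g := fun x => gradient φ x - G x)
      (ae_of_all _ fun x => enorm_sub_rev _ _)]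
    simpa using this
  have h3 : ∫⁻ x in Ω, ‖φ x‖ₑ ≤ (∫⁻ x in Ω, ‖u x‖ₑ) + ∫⁻ x in Ω, ‖u x - φ x‖ₑ := by
    rw [← lintegral_add_left' h.memLpx.1.enorm]
    refine lintegral_mono fun x => ?_
    simpa using enorm_sub_le (E := ℝ) (a := u x) (b := u x - φ x)
  calc luxNorm Ω p u ≤ (η * luxNorm Ω p (gradient φ) + C * ∫⁻ x in Ω, ‖φ x‖ₑ) + κ :=
        h1.trans (add_le_add (hC φ hφ) hκ1)
    _ ≤ (η * (luxNorm Ω p G + κ) + C * ((∫⁻ x in Ω, ‖u x‖ₑ) + V * κ)) + κ := by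
        rw [hVe]
        gcongr
        · exact h2.trans (by gcongr)
        · exact h3.trans (by gcongr; exact (hp.lintegral_enorm_le hV).trans (by gcongr))
    _ = _ := by push_cast; ring

end BoundedExponent

end Sobolev

/-! ### Genus under odd continuous maps -/

section Genus

theorem genus_le_of_odd_map {X Y : Type*} [TopologicalSpace X] [Neg X] [TopologicalSpace Y] [Neg Y]
    {A : Set X} {B : Set Y} (h : X → Y) (hc : ContinuousOn h A) (hm : MapsTo h A B)
    (ho : ∀ x ∈ A, h (-x) = -h x) : genus A ≤ genus B := by
  refine le_iInf₂ fun k ⟨f, hf, hodd, hne⟩ => iInf₂_le k ⟨f ∘ h, hf.comp hc hm, fun x hx => ?_,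
    fun x hx => hne _ (hm hx)⟩
  simp only [Function.comp_apply, ho x hx, hodd _ (hm hx)]

theorem image_mem_symmFamily {X Y : Type*} [TopologicalSpace X] [InvolutiveNeg X]
    [TopologicalSpace Y] [InvolutiveNeg Y] {S : Set X} {T : Set Y} {m : ℕ} {K : Set X}
    (hK : K ∈ symmFamily S m) (h : X → Y) (hc : ContinuousOn h K) (hm : MapsTo h K T)
    (ho : ∀ x ∈ K, h (-x) = -h x) : h '' K ∈ symmFamily T m := by
  obtain ⟨_, hKc, hKs, hKg⟩ := hK
  have hneg : ∀ x ∈ K, -x ∈ K := fun x hx => by rw [hKs] at hx; exact hx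
  refine ⟨hm.image_subset, hKc.image_of_continuousOn hc, ?_,
    hKg.trans (genus_le_of_odd_map h hc (mapsTo_image h K) ho)⟩
  ext y
  constructor
  · rintro ⟨x, hx, rfl⟩
    exact ⟨-x, hneg x hx, ho x hx⟩
  · rintro ⟨x, hx, hxy⟩
    exact ⟨-x, hneg x hx, by rw [ho x hx, hxy, neg_neg]⟩

end Genus

/-! ### Odd Schauder projections and continuity of finite combinations -/

section OddApproximation

variable {V : Type*} [NormedAddCommGroup V] [NormedSpace ℝ V]

/-- A compact set is uniformly approximated by an odd continuous map into the symmetric convex hull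
of finitely many of its points. -/
theorem exists_odd_finite_combination {K : Set V} (hK : IsCompact K) {δ : ℝ} (hδ : 0 < δ) :
    ∃ (t : Finset V) (β : V → V → ℝ), ↑t ⊆ K ∧ (∀ w, ContinuousOn (β w) K) ∧
      (∀ w u, β w (-u) = -β w u) ∧
      ∀ u ∈ K, ∑ w ∈ t, |β w u| ≤ 1 ∧ ‖u - ∑ w ∈ t, β w u • w‖ ≤ δ := by
  obtain ⟨t', ht'K, ht'f, hcov⟩ := hK.finite_cover_balls hδ
  obtain ⟨t, rfl⟩ := ht'f.exists_finset_coe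
  -- Unnormalised Schauder weights, supported in the `δ`-balls about the points `w`. Taking `a w u -
  -- a w (-u)` as numerator and the even sum `S` as denominator makes the coefficients odd.
  set a : V → V → ℝ := fun w u => max 0 (δ - ‖u - w‖)
  set S : V → ℝ := fun u => ∑ w ∈ t, (a w u + a w (-u))
  have ha0 : ∀ w u, 0 ≤ a w u := fun w u => le_max_left _ _
  have hac : ∀ w, Continuous (a w) := fun w => by fun_prop
  have hSc : Continuous S := by fun_prop
  have hSneg : ∀ u, S (-u) = S u := fun u => by
    simp only [S, neg_neg]
    exact Finset.sum_congr rfl fun w _ => add_comm _ _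
  have hS : ∀ u ∈ K, 0 < S u := fun u hu => by
    obtain ⟨w, hw, huw⟩ := mem_iUnion₂.1 (hcov hu)
    rw [Metric.mem_ball, dist_eq_norm] at huw
    refine Finset.sum_pos' (fun w _ => add_nonneg (ha0 _ _) (ha0 _ _)) ⟨w, hw, ?_⟩
    exact add_pos_of_pos_of_nonneg (lt_max_of_lt_right (by linarith)) (ha0 _ _)
  have hbound : ∀ w u, a w u * ‖u - w‖ ≤ a w u * δ := fun w u => by
    rcases le_total ‖u - w‖ δ with h | h
    · exact mul_le_mul_of_nonneg_left h (ha0 _ _)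
    · simp [a, max_eq_left (sub_nonpos.2 h)]
  refine ⟨t, fun w u => (a w u - a w (-u)) / S u, ht'K, fun w => ?_, fun w u => ?_, fun u hu => ?_⟩
  · exact ContinuousOn.div (by fun_prop) hSc.continuousOn fun u hu => (hS u hu).ne'
  · simp only [hSneg, neg_neg, ← neg_div, neg_sub]
  have hSu := hS u hu
  constructor
  · calc ∑ w ∈ t, |(a w u - a w (-u)) / S u| ≤ ∑ w ∈ t, (a w u + a w (-u)) / S u := by
          refine Finset.sum_le_sum fun w _ => ?_
          rw [abs_div, abs_of_pos hSu]
          gcongr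
          rw [abs_le]
          constructor <;> linarith [ha0 w u, ha0 w (-u)]
      _ = 1 := by rw [← Finset.sum_div, div_self hSu.ne']
  -- The error is an average of the vectors `u - w` and `u + w`, each with a weight that vanishes
  -- unless its length is below `δ`.
  · have e : S u • (u - ∑ w ∈ t, ((a w u - a w (-u)) / S u) • w) =
        ∑ w ∈ t, (a w u • (u - w) - a w (-u) • (-u - w)) := by
      rw [smul_sub, Finset.smul_sum, Finset.sum_smul, ← Finset.sum_sub_distrib]
      refine Finset.sum_congr rfl fun w _ => ?_
      rw [smul_smul, mul_div_cancel₀ _ hSu.ne']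
      module
    have h1 : S u * ‖u - ∑ w ∈ t, ((a w u - a w (-u)) / S u) • w‖ ≤ S u * δ := by
      calc S u * ‖u - ∑ w ∈ t, ((a w u - a w (-u)) / S u) • w‖
          = ‖∑ w ∈ t, (a w u • (u - w) - a w (-u) • (-u - w))‖ := by
            rw [← e, norm_smul, Real.norm_of_nonneg hSu.le]
        _ ≤ ∑ w ∈ t, (a w u + a w (-u)) * δ := by
            refine norm_sum_le_of_le _ fun w _ => (norm_sub_le _ _).trans ?_
            rw [norm_smul, norm_smul, Real.norm_of_nonneg (ha0 _ _), Real.norm_of_nonneg (ha0 _ _),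
              add_mul]
            exact add_le_add (hbound _ _) (hbound _ _)
        _ = S u * δ := by rw [← Finset.sum_mul]
    exact le_of_mul_le_mul_left h1 hSu

variable {E : V → ℝ≥0∞}

theorem sum_smul_le_of_subadditive (hadd : ∀ u v, E (u + v) ≤ E u + E v)
    (hsmul : ∀ (c : ℝ) u, E (c • u) = ‖c‖ₑ * E u) {ι : Type*} (s : Finset ι) (c : ι → ℝ)
    (u : ι → V) : E (∑ i ∈ s, c i • u i) ≤ ∑ i ∈ s, ‖c i‖ₑ * E (u i) := by
  have h0 : E 0 = 0 := by simpa using hsmul 0 0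
  refine (Finset.le_sum_of_subadditive E h0.le hadd s _).trans_eq ?_
  simp only [hsmul]

/-- On combinations of finitely many vectors of finite `E`, coefficientwise convergence controls
`E`, even though `E` need not be continuous on `V`. It is used with the energy and with the
Luxemburg norm. -/
theorem tendsto_sum_smul_sub_zero (hadd : ∀ u v, E (u + v) ≤ E u + E v)
    (hsmul : ∀ (c : ℝ) u, E (c • u) = ‖c‖ₑ * E u) {X : Type*} [TopologicalSpace X] {K : Set X}
    (t : Finset V) (ht : ∀ w ∈ t, E w ≠ ⊤) {c : V → X → ℝ} (hc : ∀ w, ContinuousOn (c w) K)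
    {x₀ : X} (hx₀ : x₀ ∈ K) :
    Filter.Tendsto (fun x => E (∑ w ∈ t, c w x • w - ∑ w ∈ t, c w x₀ • w))
      (nhdsWithin x₀ K) (nhds 0) := by
  have h1 : Filter.Tendsto (fun x => ∑ w ∈ t, ‖c w x - c w x₀‖ₑ * E w)
      (nhdsWithin x₀ K) (nhds (∑ w ∈ t, ‖c w x₀ - c w x₀‖ₑ * E w)) := by
    refine tendsto_finsetSum _ fun w hw => ENNReal.Tendsto.mul_const ?_ (Or.inr (ht w hw))
    exact (((hc w) x₀ hx₀).sub tendsto_const_nhds).enorm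
  simp only [sub_self, enorm_zero, zero_mul, Finset.sum_const_zero] at h1
  refine tendsto_of_tendsto_of_tendsto_of_le_of_le tendsto_const_nhds h1 (fun _ => bot_le)
    fun x => ?_
  simp only [← Finset.sum_sub_distrib, ← sub_smul]
  exact sum_smul_le_of_subadditive hadd hsmul t (fun w => c w x - c w x₀) id

end OddApproximation

/-! ### Comparison of the two minimax values -/

section Minimax

variable {Ω : Set (Euc N)} {p : Euc N → ℝ} {b : ℝ}

/-- Every open set around `u` contains a ball about `u` by definition of the topology, so this
direction does not require balls to be open. -/
theorem W0.tendsto_of_gradNorm {X : Type*} {l : Filter X} {f : X → W0 Ω p} {u : W0 Ω p}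
    (h : Filter.Tendsto (fun x => gradNorm Ω p ((f x).1 - u.1)) l (nhds 0)) :
    Filter.Tendsto f l (nhds u) := by
  rw [tendsto_nhds]
  intro U hU hu
  obtain ⟨ε, hε, hball⟩ := hU u hu
  exact (h.eventually_lt_const hε).mono fun x hx => hball _ hx

noncomputable instance W0.instInvolutiveNeg (Ω : Set (Euc N)) (p : Euc N → ℝ) :
    InvolutiveNeg (W0 Ω p) where
  neg_neg u := Subtype.ext (neg_neg u.1)

theorem enorm_L1_eq (u : L1 Ω) : ‖u‖ₑ = ∫⁻ x in Ω, ‖u x‖ₑ := by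
  rw [Lp.enorm_def, eLpNorm_one_eq_lintegral_enorm]

theorem energy_eq_gradNorm {u : L1 Ω} (h : MemW0 Ω p u) : energy Ω p u = gradNorm Ω p u :=
  if_pos h

namespace BoundedExponent

theorem memW0_iff (hp : BoundedExponent Ω p b) (hΩ : IsOpen Ω) {u : L1 Ω} :
    MemW0 Ω p u ↔ energy Ω p u ≠ ⊤ := by
  constructor
  · intro h
    obtain ⟨G, hG⟩ := memW0_iff_exists_pair.1 h
    rw [hG.energy_eq hΩ]
    exact (hp.luxNorm_lt_top hG.memLpx_grad.2).ne
  · intro h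
    by_contra hu
    exact h (if_neg hu)

theorem luxNorm_L1_add_le (hp : BoundedExponent Ω p b) (u v : L1 Ω) :
    luxNorm Ω p (u + v : L1 Ω) ≤ luxNorm Ω p u + luxNorm Ω p v := by
  refine le_of_eq_of_le (luxNorm_congr ((Lp.coeFn_add u v).mono fun x hx => by rw [hx]; rfl))
    (hp.luxNorm_add_le (Lp.aestronglyMeasurable u))

theorem luxNorm_L1_smul (hp : BoundedExponent Ω p b) (c : ℝ) (u : L1 Ω) :
    luxNorm Ω p (c • u : L1 Ω) = ‖c‖ₑ * luxNorm Ω p u := by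
  rw [← hp.luxNorm_smul]
  exact luxNorm_congr ((Lp.coeFn_smul c u).mono fun x hx => by rw [hx]; rfl)

/-- At the level 1 neither the default value 0 of `gFun` nor the truncation of `∞` by `toNNReal` can
interfere. -/
theorem gFun_eq_one_iff (hp : BoundedExponent Ω p b) {u : L1 Ω} :
    gFun Ω p u = 1 ↔ luxNorm Ω p u = 1 := by
  rw [gFun]
  constructor
  · intro h
    split_ifs at h with hu
    · rw [← ENNReal.coe_toNNReal (hp.luxNorm_lt_top hu.2).ne, h, ENNReal.coe_one]
    · simp at h
  · intro h
    have hu : MemLpx Ω p u :=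
      ⟨Lp.aestronglyMeasurable u, hp.modular_lt_top (h.trans_lt ENNReal.one_lt_top)⟩
    rw [if_pos hu, h, ENNReal.toNNReal_one]

theorem continuous_W0_val (hp : BoundedExponent Ω p b) (hΩ : IsOpen Ω) (hN : 2 ≤ N)
    (hΩb : Bornology.IsBounded Ω) : Continuous (fun u : W0 Ω p => u.1) := by
  obtain ⟨C, hC⟩ := hp.lintegral_le_luxNorm hN hΩb
  refine continuous_def.2 fun U hU u hu => ?_
  obtain ⟨ε, hε, hball⟩ := Metric.isOpen_iff.1 hU u.1 hu
  refine ⟨ENNReal.ofReal ε / (C + 1), ENNReal.div_pos (by simpa using hε) (by simp),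
    fun v hv => hball ?_⟩
  have hmem : MemW0 Ω p (v.1 - u.1 : L1 Ω) := by
    rw [sub_eq_add_neg]; exact hp.memW0_add v.2 u.2.neg
  obtain ⟨G, hG⟩ := memW0_iff_exists_pair.1 hmem
  rw [hG.gradNorm_eq hΩ, ENNReal.lt_div_iff_mul_lt (by simp) (by simp)] at hv
  have h1 : ‖v.1 - u.1‖ₑ < ENNReal.ofReal ε := by
    rw [enorm_L1_eq]
    refine (hC _ _ hG).trans_lt (lt_of_le_of_lt ?_ hv)
    rw [mul_comm]
    gcongr
    exact le_self_add
  rw [← ofReal_norm, ENNReal.ofReal_lt_ofReal_iff hε] at h1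
  rwa [Metric.mem_ball, dist_eq_norm]

theorem exists_luxNorm_L1_le (hp : BoundedExponent Ω p b) (hΩ : IsOpen Ω) (hbN : b < N)
    (hΩb : Bornology.IsBounded Ω) (hpc : ContinuousOn p (closure Ω)) {η : ℝ≥0} (hη : 0 < η) :
    ∃ C : ℝ≥0, ∀ u : L1 Ω, MemW0 Ω p u → luxNorm Ω p u ≤ η * energy Ω p u + C * ‖u‖ₑ := by
  obtain ⟨C, hC⟩ := hp.luxNorm_le_interpolate hbN hΩb hpc hη
  refine ⟨C, fun u hu => ?_⟩
  obtain ⟨G, hG⟩ := memW0_iff_exists_pair.1 hu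
  rw [hG.energy_eq hΩ, enorm_L1_eq]
  exact hC _ _ hG

theorem iInf_familyL1_le (hp : BoundedExponent Ω p b) (hΩ : IsOpen Ω) (hN : 2 ≤ N)
    (hΩb : Bornology.IsBounded Ω) (m : ℕ) :
    ⨅ K ∈ familyL1 Ω p m, ⨆ u ∈ K, energy Ω p u ≤
      ⨅ K ∈ familyW0 Ω p m, ⨆ u ∈ K, energy Ω p u.1 := by
  refine le_iInf₂ fun K hK => iInf₂_le_of_le ((fun u : W0 Ω p => u.1) '' K) ?_ ?_
  · exact image_mem_symmFamily hK _ (hp.continuous_W0_val hΩ hN hΩb).continuousOn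
      (fun u hu => hK.1 hu) fun u _ => rfl
  · rw [iSup_image]

/-- Project `K` by an odd finite-rank map `P`, then divide by `‖P u‖_{p(x)}`. The interpolation
inequality applied to `u - P u`, whose energy is at most `2 c`, keeps this divisor above `1 / (1 +
κ)`. -/
theorem exists_mem_familyW0 (hp : BoundedExponent Ω p b) (hΩ : IsOpen Ω) (hbN : b < N)
    (hΩb : Bornology.IsBounded Ω) (hpc : ContinuousOn p (closure Ω)) {m : ℕ} {K : Set (L1 Ω)}
    (hK : K ∈ familyL1 Ω p m) {c : ℝ≥0} (hc : ∀ u ∈ K, energy Ω p u ≤ c) {κ : ℝ≥0} (hκ : 0 < κ) :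
    ∃ K' ∈ familyW0 Ω p m, ∀ u ∈ K', energy Ω p u.1 ≤ c + c * κ := by
  -- The allowed loss of norm: `1 - τ = 1 / (1 + κ)`. It is split evenly between the two terms of
  -- the interpolation inequality; the summands 1 in `2 * c + 1` and `C + 1` only prevent division
  -- by zero.
  set τ : ℝ≥0 := κ / (1 + κ) with hτ
  have hτ0 : 0 < τ := by positivity
  have hτ1 : (1 + κ)⁻¹ + τ = 1 := by rw [hτ]; field_simp
  obtain ⟨C, hC⟩ := hp.exists_luxNorm_L1_le hΩ hbN hΩb hpc
    (η := τ / (2 * (2 * c + 1))) (by positivity)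
  set δ : ℝ≥0 := τ / (2 * (C + 1)) with hδ
  have hsmall : τ / (2 * (2 * c + 1)) * (c + c) + C * δ ≤ τ := by
    rw [← NNReal.coe_le_coe, hδ]
    push_cast
    have h1 : (τ : ℝ) / (2 * (2 * c + 1)) * (c + c) ≤ τ / 2 := by
      rw [div_mul_eq_mul_div, div_le_div_iff₀ (by positivity) (by positivity)]
      nlinarith [τ.2, c.2]
    have h2 : (C : ℝ) * (τ / (2 * (C + 1))) ≤ τ / 2 := by
      rw [mul_div_assoc', div_le_div_iff₀ (by positivity) (by positivity)]
      nlinarith [τ.2, C.2]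
    linarith
  obtain ⟨t, β, htK, hβc, hβodd, hβ⟩ := exists_odd_finite_combination hK.2.1
    (δ := (δ : ℝ)) (by positivity)
  have hEadd := hp.energy_add_le hΩ
  have hEsmul := hp.energy_smul hΩ
  have htE : ∀ w ∈ t, energy Ω p w ≠ ⊤ := fun w hw =>
    ((hc w (htK hw)).trans_lt ENNReal.coe_lt_top).ne
  have htl : ∀ w ∈ t, luxNorm Ω p w = 1 := fun w hw => hp.gFun_eq_one_iff.1 (hK.1 (htK hw))
  set P : L1 Ω → L1 Ω := fun u => ∑ w ∈ t, β w u • w with hP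
  have hPodd : ∀ u, P (-u) = -P u := fun u => by simp [P, hβodd]
  -- Points of `K` have finite energy, and finite energy is membership in `W_0^{1,p(x)}(Ω)`.
  have hcomb : ∀ a : L1 Ω → ℝ, MemW0 Ω p (∑ w ∈ t, a w • w : L1 Ω) := fun a => by
    rw [hp.memW0_iff hΩ]
    refine ((sum_smul_le_of_subadditive hEadd hEsmul t a id).trans_lt ?_).ne
    exact ENNReal.sum_lt_top.2 fun w hw => ENNReal.mul_lt_top (by simp) (htE w hw).lt_top
  have hPE : ∀ u ∈ K, energy Ω p (P u) ≤ c := fun u hu => by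
    calc energy Ω p (P u) ≤ ∑ w ∈ t, ‖β w u‖ₑ * energy Ω p w :=
          sum_smul_le_of_subadditive hEadd hEsmul t (fun w => β w u) id
      _ ≤ ∑ w ∈ t, ‖β w u‖ₑ * c := Finset.sum_le_sum fun w hw => by
          gcongr; exact hc w (htK hw)
      _ = ENNReal.ofReal (∑ w ∈ t, |β w u|) * c := by
          rw [← Finset.sum_mul, ENNReal.ofReal_sum_of_nonneg fun _ _ => abs_nonneg _]
          simp only [Real.enorm_eq_ofReal_abs]
      _ ≤ 1 * c := by
          gcongr
          simpa using (hβ u hu).1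
      _ = c := one_mul _
  have hlfin : ∀ u, luxNorm Ω p (P u) ≠ ⊤ := fun u => (hp.luxNorm_lt_top (hcomb _).1.2).ne
  have hlow : ∀ u ∈ K, ((1 + κ)⁻¹ : ℝ≥0) ≤ luxNorm Ω p (P u) := fun u hu => by
    have hdiff : luxNorm Ω p (u - P u : L1 Ω) ≤ τ := by
      have hEu : energy Ω p (u - P u) ≤ c + c := by
        rw [sub_eq_add_neg]
        refine (hEadd _ _).trans (add_le_add (hc u hu) ?_)
        rw [hp.energy_neg hΩ]
        exact hPE u hu
      have hn : ‖u - P u‖ₑ ≤ δ := by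
        rw [← ofReal_norm, ← ENNReal.ofReal_coe_nnreal]
        exact ENNReal.ofReal_le_ofReal (hβ u hu).2
      refine (hC _ ((hp.memW0_iff hΩ).2 (hEu.trans_lt (by simp)).ne)).trans ?_
      calc _ ≤ ((τ / (2 * (2 * c + 1)) : ℝ≥0) : ℝ≥0∞) * (c + c) + C * δ := by gcongr
        _ ≤ τ := by exact_mod_cast hsmall
    have h1 : luxNorm Ω p u ≤ luxNorm Ω p (P u) + τ := by
      have := hp.luxNorm_L1_add_le (P u) (u - P u)
      rw [add_sub_cancel] at this
      exact this.trans (by gcongr)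
    have hτ1' : (((1 + κ)⁻¹ : ℝ≥0) : ℝ≥0∞) + τ = 1 := by exact_mod_cast hτ1
    rw [hp.gFun_eq_one_iff.1 (hK.1 hu)] at h1
    exact (ENNReal.add_le_add_iff_right (by simp)).1 (hτ1'.le.trans h1)
  set g : L1 Ω → ℝ := fun u => (luxNorm Ω p (P u)).toReal with hg
  have hgE : ∀ u, ENNReal.ofReal (g u) = luxNorm Ω p (P u) := fun u =>
    ENNReal.ofReal_toReal (hlfin u)
  have hgpos : ∀ u ∈ K, 0 < g u := fun u hu => by
    refine ENNReal.toReal_pos (ne_of_gt (lt_of_lt_of_le ?_ (hlow u hu))) (hlfin u)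
    simp
  have hneg : ∀ u, luxNorm Ω p (P (-u)) = luxNorm Ω p (P u) := fun u => by
    have := hp.luxNorm_L1_smul (-1) (P u)
    rw [hPodd]
    simpa using this
  have hgneg : ∀ u, g (-u) = g u := fun u => by simp only [g, hneg]
  have hgc : ContinuousOn g K := by
    intro u₀ hu₀
    have h0 := tendsto_sum_smul_sub_zero hp.luxNorm_L1_add_le hp.luxNorm_L1_smul t
      (fun w hw => by simp [htl w hw]) hβc hu₀
    have h1 := (ENNReal.tendsto_toReal ENNReal.zero_ne_top).comp h0
    rw [ContinuousWithinAt, tendsto_iff_dist_tendsto_zero]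
    refine squeeze_zero (fun _ => dist_nonneg) (fun u => ?_) h1
    have hfin : luxNorm Ω p (P u - P u₀ : L1 Ω) ≠ ⊤ := by
      have : P u - P u₀ = ∑ w ∈ t, (β w u - β w u₀) • w := by
        simp only [P, ← Finset.sum_sub_distrib, ← sub_smul]
      rw [this]
      exact (hp.luxNorm_lt_top (hcomb _).1.2).ne
    have hrev : luxNorm Ω p (P u₀ - P u : L1 Ω) = luxNorm Ω p (P u - P u₀ : L1 Ω) := by
      have := hp.luxNorm_L1_smul (-1) (P u - P u₀)
      simpa using this
    have h2 := hp.luxNorm_L1_add_le (P u₀) (P u - P u₀)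
    have h3 := hp.luxNorm_L1_add_le (P u) (P u₀ - P u)
    rw [add_sub_cancel] at h2 h3
    rw [hrev] at h3
    have h2' := ENNReal.toReal_mono (ENNReal.add_ne_top.2 ⟨hlfin u₀, hfin⟩) h2
    have h3' := ENNReal.toReal_mono (ENNReal.add_ne_top.2 ⟨hlfin u, hfin⟩) h3
    rw [ENNReal.toReal_add (hlfin _) hfin] at h2' h3'
    rw [Real.dist_eq, abs_le]
    simp only [Function.comp_apply]
    change g u ≤ g u₀ + _ at h2'
    change g u₀ ≤ g u + _ at h3'
    constructor
    · linarith
    · linarith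
  have hQmem : ∀ u, MemW0 Ω p ((g u)⁻¹ • P u : L1 Ω) := fun u => hp.memW0_smul (hcomb _) _
  set Q : L1 Ω → W0 Ω p := fun u => ⟨(g u)⁻¹ • P u, hQmem u⟩ with hQ
  have hginv : ∀ u ∈ K, ‖(g u)⁻¹‖ₑ = (luxNorm Ω p (P u))⁻¹ := fun u hu => by
    rw [enorm_inv (hgpos u hu).ne', Real.enorm_of_nonneg (hgpos u hu).le, hgE]
  refine ⟨Q '' K, image_mem_symmFamily hK Q ?_ ?_ ?_, ?_⟩
  · intro u₀ hu₀
    refine W0.tendsto_of_gradNorm ?_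
    -- The normalising factor is absorbed into the coefficients, so the normalised map is again a
    -- finite combination with continuous coefficients.
    have h0 := tendsto_sum_smul_sub_zero hEadd hEsmul t htE
      (c := fun w u => (g u)⁻¹ * β w u)
      (fun w => (hgc.inv₀ fun u hu => (hgpos u hu).ne').mul (hβc w)) hu₀
    refine h0.congr fun u => ?_
    have e : ∀ v, (Q v).1 = ∑ w ∈ t, ((g v)⁻¹ * β w v) • w := fun v => by
      simp only [Q, P, Finset.smul_sum, smul_smul]
    rw [← e, ← e]
    refine energy_eq_gradNorm ?_
    rw [sub_eq_add_neg]
    exact hp.memW0_add (Q u).2 (Q u₀).2.neg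
  · intro u hu
    refine hp.gFun_eq_one_iff.2 ?_
    change luxNorm Ω p ((g u)⁻¹ • P u : L1 Ω) = 1
    rw [hp.luxNorm_L1_smul, hginv u hu, ENNReal.inv_mul_cancel ?_ (hlfin u)]
    intro h
    exact (hgpos u hu).ne' (by simp [g, h])
  · intro u _
    refine Subtype.ext ?_
    change (g (-u))⁻¹ • P (-u) = -((g u)⁻¹ • P u)
    rw [hgneg, hPodd, smul_neg]
  · rintro _ ⟨u, hu, rfl⟩
    change energy Ω p ((g u)⁻¹ • P u) ≤ _
    rw [hEsmul, hginv u hu]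
    calc (luxNorm Ω p (P u))⁻¹ * energy Ω p (P u) ≤ (((1 + κ)⁻¹ : ℝ≥0) : ℝ≥0∞)⁻¹ * c := by
          gcongr
          · exact hlow u hu
          · exact hPE u hu
      _ = c + c * κ := by
          rw [ENNReal.coe_inv (by positivity), inv_inv]
          push_cast
          ring

/-- A competitor with infinite supremum is harmless; otherwise let `κ` tend to 0 in
`exists_mem_familyW0`. -/
theorem iInf_familyW0_le (hp : BoundedExponent Ω p b) (hΩ : IsOpen Ω) (hbN : b < N)
    (hΩb : Bornology.IsBounded Ω) (hpc : ContinuousOn p (closure Ω)) (m : ℕ) :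
    ⨅ K ∈ familyW0 Ω p m, ⨆ u ∈ K, energy Ω p u.1 ≤
      ⨅ K ∈ familyL1 Ω p m, ⨆ u ∈ K, energy Ω p u := by
  refine le_iInf₂ fun K hK => ?_
  rcases eq_or_ne (⨆ u ∈ K, energy Ω p u) ⊤ with h | h
  · rw [h]; exact le_top
  lift (⨆ u ∈ K, energy Ω p u) to ℝ≥0 using h with c hc
  refine ENNReal.le_of_forall_le_add_mul c fun κ hκ => ?_
  obtain ⟨K', hK', hle⟩ := hp.exists_mem_familyW0 hΩ hbN hΩb hpc hK (c := c)
    (fun u hu => hc ▸ le_iSup₂ (f := fun u (_ : u ∈ K) => energy Ω p u) u hu) hκ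
  exact iInf₂_le_of_le K' hK' (iSup₂_le hle)

end BoundedExponent

/-- Compactness of `closure Ω` makes `p '' Ω` bounded, so that the real `sInf` and `sSup` are
genuine bounds rather than default values. -/
theorem AdmissibleExponent.boundedExponent (hΩ : IsOpen Ω) (hΩb : Bornology.IsBounded Ω)
    (hp : AdmissibleExponent Ω p) : BoundedExponent Ω p (sSup (p '' Ω)) := by
  have hK : IsCompact (p '' closure Ω) := hΩb.isCompact_closure.image_of_continuousOn hp.continuousOn
  have hsub : p '' Ω ⊆ p '' closure Ω := image_mono subset_closure
  exact
    { measurableSet := hΩ.measurableSet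
      aemeasurable := (hp.continuousOn.mono subset_closure).aemeasurable hΩ.measurableSet
      one_le := fun x hx => hp.one_lt_inf.le.trans
        (csInf_le (hK.bddBelow.mono hsub) (mem_image_of_mem p hx))
      le := fun x hx => le_csSup (hK.bddAbove.mono hsub) (mem_image_of_mem p hx) }

end Minimax

end VarExp

theorem theorem2p11 {N : ℕ} (hN : 2 ≤ N) (Ω : Set (VarExp.Euc N)) (hΩ_open : IsOpen Ω)
    (hΩ_conn : IsConnected Ω) (hΩ_bdd : Bornology.IsBounded Ω)
    (hΩ_lip : VarExp.HasLipschitzBoundary Ω)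
    (p : VarExp.Euc N → ℝ) (hp : VarExp.AdmissibleExponent Ω p) :
    ConvexOn ℝ≥0 Set.univ (VarExp.energy Ω p) ∧
    (∀ u : VarExp.L1 Ω, VarExp.energy Ω p (-u) = VarExp.energy Ω p u) ∧
    (∀ (t : ℝ≥0) (u : VarExp.L1 Ω),
      VarExp.energy Ω p ((t : ℝ) • u) = (t : ℝ≥0∞) * VarExp.energy Ω p u) ∧
    ∀ m : ℕ, 1 ≤ m →
      (⨅ K ∈ VarExp.familyL1 Ω p m, ⨆ u ∈ K, VarExp.energy Ω p u) =
        ⨅ K ∈ VarExp.familyW0 Ω p m, ⨆ u ∈ K, VarExp.energy Ω p u.1 := by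
  have hb := hp.boundedExponent hΩ_open hΩ_bdd
  refine ⟨hb.convexOn_energy hΩ_open, hb.energy_neg hΩ_open, fun t u => ?_, fun m _ =>
    le_antisymm (hb.iInf_familyL1_le hΩ_open hN hΩ_bdd m)
      (hb.iInf_familyW0_le hΩ_open hp.sup_lt hΩ_bdd hp.continuousOn m)⟩
  rw [hb.energy_smul hΩ_open, Real.enorm_of_nonneg t.coe_nonneg, ENNReal.ofReal_coe_nnreal]
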